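/- Let $n\ge 2$ and let $\mathcal U\subset\mathbb R^n$ be a bounded open convex set. Let $F$ be a strongly convex Finsler metric on $\mathcal U$, i.e. a continuous function $F:\mathcal U\times\mathbb R^n\to[0,\infty)$ which is smooth on $\{(x,y): y\neq 0\}$, such that each $F(x,\cdot)$ is subadditive, positively homogeneous of degree $1$ and positive on nonzero vectors, and whose fundamental tensor $g_{ij}(x,y)=\frac12\frac{\partial^2F^2}{\partial y^i\partial y^j}(x,y)$ is positive definite for all $x\in\mathcal U$, $y\ne0$. Then the following are equivalent. (1) $F$ is the Hilbert metric of $\mathcal U$, i.e. $F(x,\xi)=\frac12\big(F_f(x,\xi)+F_f(x,-\xi)\big)$ for all $x\in\mathcal U$, $\xi\in\mathbb R^n$, where $F_f(x,\xi)=\inf\{t>0: x+\xi/t\in\mathcal U\}$. (2) $F$ has the following three properties. - $F$ is projectively flat: for all $p\neq q$ in $\mathcal U$, the affine segment from $p$ to $q$ can be parametrized as a geodesic, i.e. as a $C^1$ curve $\beta:[a,b]\to\mathcal U$ that is a critical point, among curves with fixed end points, of the energy $\int_a^bF(\beta,\dot\beta)^2\,ds$. - $F$ is forward and backward complete. That is,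 with $d(p,q)$ the infimum of the lengths $\int_0^1F(\beta,\dot\beta)\,ds$ of the smooth curves $\beta:[0,1]\to\mathcal U$ from $p$ to $q$, a sequence $(x_i)$ in $\mathcal U$ converges to a point of $\mathcal U$ as soon as it is forward Cauchy (for every $\varepsilon>0$ there is $N$ with $d(x_i,x_{i+k})<\varepsilon$ for all $i\ge N$, $k\ge0$) or backward Cauchy (the same with $d(x_{i+k},x_i)<\varepsilon$). - $F$ has constant flag curvature $\mathbf K=-1$: for all $x\in\mathcal U$ and all linearly independent $y,w\in\mathbb R^n$, $$\frac{g_{im}R^i{}_k\,w^kw^m}{F^2\,g_{ij}w^iw^j-(g_{ij}w^iy^j)^2}=-1\quad\text{at }(x,y),$$ where $R^i{}_k=2\frac{\partial G^i}{\partial x^k}-\frac{\partial^2G^i}{\partial x^j\partial y^k}y^j+2G^j\frac{\partial^2G^i}{\partial y^j\partial y^k}-\frac{\partial G^i}{\partial y^j}\frac{\partial G^j}{\partial y^k}$ is the Riemann curvature, $G^k=\frac14g^{km}\big(\frac{\partial g_{im}}{\partial x^j}+\frac{\partial g_{jm}}{\partial x^i}-\frac{\partial g_{ij}}{\partial x^m}\big)y^iy^j$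 are the spray coefficients, $(g^{km})$ is the inverse of $(g_{km})$, and repeated indices are summed. -/

import Mathlib

namespace Finsler

open Set Filter Topology
open scoped ContDiff

/-- The model space `ℝⁿ`. A Finsler metric on an open set `U ⊆ ℝⁿ` is a function
`F : ℝⁿ → ℝⁿ → ℝ`, `F x ξ` being the length of the tangent vector `ξ` at `x`;
only its values at points `x ∈ U` matter. -/
abbrev Space (n : ℕ) : Type := EuclideanSpace ℝ (Fin n)

/-- The `i`-th standard basis vector. -/
noncomputable def basisVec {n : ℕ} (i : Fin n) : Space n := EuclideanSpace.single i 1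

/-- `∂f/∂xⁱ` for a function `f (x, y)` of base point and vector. -/
noncomputable def partialX {n : ℕ} (i : Fin n) (f : Space n → Space n → ℝ) :
    Space n → Space n → ℝ :=
  fun x y => fderiv ℝ (fun z => f z y) x (basisVec i)

/-- `∂f/∂yⁱ` for a function `f (x, y)` of base point and vector. -/
noncomputable def partialY {n : ℕ} (i : Fin n) (f : Space n → Space n → ℝ) :
    Space n → Space n → ℝ :=
  fun x y => fderiv ℝ (fun v => f x v) y (basisVec i)

/-! ### Finsler metrics -/

/-- `F` is a Finsler structure on `U`: finite, continuous, positive off the zero section and,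
at each point, subadditive and positively homogeneous. -/
structure IsFinslerMetric {n : ℕ} (U : Set (Space n)) (F : Space n → Space n → ℝ) : Prop where
  continuousOn : ContinuousOn (fun p : Space n × Space n => F p.1 p.2) (U ×ˢ univ)
  pos : ∀ x ∈ U, ∀ ξ : Space n, ξ ≠ 0 → 0 < F x ξ
  add_le : ∀ x ∈ U, ∀ ξ η : Space n, F x (ξ + η) ≤ F x ξ + F x η
  smul : ∀ x ∈ U, ∀ c : ℝ, 0 ≤ c → ∀ ξ : Space n, F x (c • ξ) = c * F x ξ

/-- The fundamental tensor `g_ij (x, y) = ½ ∂²F²/∂yⁱ∂yʲ`. -/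
noncomputable def fundamentalTensor {n : ℕ} (F : Space n → Space n → ℝ) (x y : Space n) :
    Matrix (Fin n) (Fin n) ℝ :=
  Matrix.of fun i j => (1 / 2 : ℝ) * partialY i (partialY j fun z v => F z v ^ 2) x y

/-- `F` is a strongly convex Finsler metric on `U`: smooth on the slit tangent bundle, with
positive definite fundamental tensor there. -/
structure IsStronglyConvex {n : ℕ} (U : Set (Space n)) (F : Space n → Space n → ℝ) : Prop
    extends IsFinslerMetric U F where
  smooth : ContDiffOn ℝ ∞ (fun p : Space n × Space n => F p.1 p.2) (U ×ˢ {0}ᶜ)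
  posDef : ∀ x ∈ U, ∀ y : Space n, y ≠ 0 → (fundamentalTensor F x y).PosDef

/-! ### Length, distance, completeness -/

/-- The length of the curve `β : [a, b] → ℝⁿ`. -/
noncomputable def length {n : ℕ} (F : Space n → Space n → ℝ) (a b : ℝ) (β : ℝ → Space n) : ℝ :=
  ∫ s in a..b, F (β s) (derivWithin β (Icc a b) s)

/-- The distance `d_F (p, q)`: the infimum of the lengths of the smooth curves `[0, 1] → U`
from `p` to `q`. -/
noncomputable def finslerDist {n : ℕ} (U : Set (Space n)) (F : Space n → Space n → ℝ)
    (p q : Space n) : ℝ :=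
  sInf {l : ℝ | ∃ β : ℝ → Space n, ContDiffOn ℝ ∞ β (Icc 0 1) ∧ (∀ s ∈ Icc (0 : ℝ) 1, β s ∈ U) ∧
    β 0 = p ∧ β 1 = q ∧ l = length F 0 1 β}

/-- Every forward Cauchy sequence in `U` converges to a point of `U`. -/
def IsForwardComplete {n : ℕ} (U : Set (Space n)) (F : Space n → Space n → ℝ) : Prop :=
  ∀ x : ℕ → Space n, (∀ i, x i ∈ U) →
    (∀ ε : ℝ, 0 < ε → ∃ N : ℕ, ∀ i, N ≤ i → ∀ k, finslerDist U F (x i) (x (i + k)) < ε) →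
    ∃ z ∈ U, Tendsto x atTop (𝓝 z)

/-- Every backward Cauchy sequence in `U` converges to a point of `U`. -/
def IsBackwardComplete {n : ℕ} (U : Set (Space n)) (F : Space n → Space n → ℝ) : Prop :=
  ∀ x : ℕ → Space n, (∀ i, x i ∈ U) →
    (∀ ε : ℝ, 0 < ε → ∃ N : ℕ, ∀ i, N ≤ i → ∀ k, finslerDist U F (x (i + k)) (x i) < ε) →
    ∃ z ∈ U, Tendsto x atTop (𝓝 z)

/-- Forward and backward completeness. -/
def IsComplete {n : ℕ} (U : Set (Space n)) (F : Space n → Space n → ℝ) : Prop :=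
  IsForwardComplete U F ∧ IsBackwardComplete U F

/-! ### Geodesics, projective flatness -/

/-- The energy of the curve `β : [a, b] → ℝⁿ`. -/
noncomputable def energy {n : ℕ} (F : Space n → Space n → ℝ) (a b : ℝ) (β : ℝ → Space n) : ℝ :=
  ∫ s in a..b, F (β s) (derivWithin β (Icc a b) s) ^ 2

/-- The `C¹` curve `β : [a, b] → U` is a geodesic: it is a critical point of the energy with
respect to all `C¹` variations `β + ε η` with fixed end points. -/
structure IsGeodesic {n : ℕ} (U : Set (Space n)) (F : Space n → Space n → ℝ) (a b : ℝ)
    (β : ℝ → Space n) : Prop where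
  contDiffOn : ContDiffOn ℝ 1 β (Icc a b)
  mem : ∀ s ∈ Icc a b, β s ∈ U
  critical : ∀ η : ℝ → Space n, ContDiffOn ℝ 1 η (Icc a b) → η a = 0 → η b = 0 →
    HasDerivAt (fun ε : ℝ => energy F a b (fun s => β s + ε • η s)) 0 0

/-- Every affine segment of `U`, in either direction, can be parametrized as a geodesic. -/
def IsProjectivelyFlat {n : ℕ} (U : Set (Space n)) (F : Space n → Space n → ℝ) : Prop :=
  ∀ p q : Space n, p ≠ q → segment ℝ p q ⊆ U →
    ∃ (a b : ℝ) (β : ℝ → Space n), a < b ∧ IsGeodesic U F a b β ∧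
      BijOn β (Icc a b) (segment ℝ p q) ∧ β a = p ∧ β b = q

/-! ### Flag curvature -/

/-- The formal Christoffel symbols
`γᵏ_ij = ½ gᵏᵐ (∂g_im/∂xʲ + ∂g_jm/∂xⁱ - ∂g_ij/∂xᵐ)`. -/
noncomputable def formalChristoffel {n : ℕ} (F : Space n → Space n → ℝ) (k i j : Fin n)
    (x y : Space n) : ℝ :=
  (1 / 2 : ℝ) * ∑ m, (fundamentalTensor F x y)⁻¹ k m *
    (partialX j (fun z v => fundamentalTensor F z v i m) x y
      + partialX i (fun z v => fundamentalTensor F z v j m) x y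
      - partialX m (fun z v => fundamentalTensor F z v i j) x y)

/-- The spray coefficients `Gᵏ = ½ γᵏ_ij yⁱ yʲ`. -/
noncomputable def sprayCoeff {n : ℕ} (F : Space n → Space n → ℝ) (k : Fin n) (x y : Space n) : ℝ :=
  (1 / 2 : ℝ) * ∑ i, ∑ j, formalChristoffel F k i j x y * y i * y j

/-- The components of the Riemann curvature `R_y`,
`Rⁱ_k = 2 ∂Gⁱ/∂xᵏ - yʲ ∂²Gⁱ/∂xʲ∂yᵏ + 2 Gʲ ∂²Gⁱ/∂yʲ∂yᵏ - ∂Gⁱ/∂yʲ ∂Gʲ/∂yᵏ`. -/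
noncomputable def riemannCurvature {n : ℕ} (F : Space n → Space n → ℝ) (x y : Space n) :
    Matrix (Fin n) (Fin n) ℝ :=
  Matrix.of fun i k =>
    2 * partialX k (sprayCoeff F i) x y
      - ∑ j, partialX j (partialY k (sprayCoeff F i)) x y * y j
      + 2 * ∑ j, sprayCoeff F j x y * partialY j (partialY k (sprayCoeff F i)) x y
      - ∑ j, partialY j (sprayCoeff F i) x y * partialY k (sprayCoeff F j) x y

/-- The pairing `g_y (u, v) = g_ij (x, y) uⁱ vʲ`. -/
noncomputable def fundamentalForm {n : ℕ} (F : Space n → Space n → ℝ) (x y u v : Space n) : ℝ :=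
  ∑ i, ∑ j, fundamentalTensor F x y i j * u i * v j

/-- The flag curvature at `x` of the flag with flagpole `y` and plane `span {y, w}`:
`K = g_y (R_y w, w) / (F² g_y (w, w) - g_y (w, y)²)`. -/
noncomputable def flagCurvature {n : ℕ} (F : Space n → Space n → ℝ) (x y w : Space n) : ℝ :=
  fundamentalForm F x y (WithLp.toLp 2 fun i => ∑ k, riemannCurvature F x y i k * w k) w /
    (F x y ^ 2 * fundamentalForm F x y w w - fundamentalForm F x y w y ^ 2)

/-- The flag curvature of `F` on `U` is equal to the constant `κ`, for every flag. -/
def HasConstantFlagCurvature {n : ℕ} (U : Set (Space n)) (F : Space n → Space n → ℝ) (κ : ℝ) :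
    Prop :=
  ∀ x ∈ U, ∀ y w : Space n, LinearIndependent ℝ ![y, w] → flagCurvature F x y w = κ

/-! ### The Hilbert metric -/

/-- The tautological (Funk) Lagrangian `F_f (x, ξ) = inf {t > 0 | x + ξ / t ∈ U}`. -/
noncomputable def funkMetric {n : ℕ} (U : Set (Space n)) (x ξ : Space n) : ℝ :=
  sInf {t : ℝ | 0 < t ∧ x + t⁻¹ • ξ ∈ U}

/-- The Hilbert metric, `F_h (x, ξ) = ½ (F_f (x, ξ) + F_f (x, -ξ))`. -/
noncomputable def hilbertMetric {n : ℕ} (U : Set (Space n)) (x ξ : Space n) : ℝ :=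
  (1 / 2 : ℝ) * (funkMetric U x ξ + funkMetric U x (-ξ))

end Finsler

/-! Let `S = yʲ ∂/∂xʲ` be the flat spray. If straight lines are geodesics of `F`, the spray of `F`
is `Gᵏ = P yᵏ` with a *projective factor* `P`, and `S F = 2 P F`; the Riemann curvature of this
spray shows that curvature `-1` forces `S P = P² + F²`. Along a line `t ↦ x + t y` the functions
`P + F` and `P - F` therefore both solve the Riccati equation `u' = u²`, so that `1 / F` is a
quadratic polynomial in `t`; completeness in both directions says that its roots are the two end
points of the chord, and this is the Hilbert metric.

Conversely, the Funk metric `A` and its reverse `B (x, y) = A (x, -y)` solve Okada's equations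
`A_{xᵏ} = A A_{yᵏ}` and `B_{xᵏ} = -B B_{yᵏ}`. Hence `F = (A + B) / 2` and `P = (A - B) / 2` solve
Berwald's system `F_{xᵏ} = (P F)_{yᵏ}`, `P_{xᵏ} = P P_{yᵏ} + F F_{yᵏ}`, which makes `P` the
projective factor of `F` and the curvature `-1`. Completeness follows because the logarithms of
affine functions that are positive on `U` are Lipschitz for the Hilbert distance. -/

namespace Finsler

open Set Filter Topology
open scoped ContDiff

section

variable {n : ℕ} {U : Set (Space n)} {f g : Space n → Space n → ℝ} {x y : Space n}

/-! ### Calculus on the slit tangent bundle -/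

/-- `f (x, y)` is smooth for `x ∈ U`, `y ≠ 0`. -/
def IsSmoothOffZero (U : Set (Space n)) (f : Space n → Space n → ℝ) : Prop :=
  ContDiffOn ℝ ∞ (fun p : Space n × Space n => f p.1 p.2) (U ×ˢ {0}ᶜ)

/-- The flat spray `yʲ ∂/∂xʲ`, as a derivation on functions of `(x, y)`. -/
noncomputable def flatSpray (f : Space n → Space n → ℝ) (x y : Space n) : ℝ :=
  ∑ j, y j * partialX j f x y

theorem isOpen_slit (hU : IsOpen U) : IsOpen (U ×ˢ ({0}ᶜ : Set (Space n))) :=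
  hU.prod isOpen_compl_singleton

theorem slit_mem_nhds (hU : IsOpen U) (hx : x ∈ U) (hy : y ≠ 0) :
    U ×ˢ ({0}ᶜ : Set (Space n)) ∈ 𝓝 (x, y) :=
  (isOpen_slit hU).mem_nhds ⟨hx, hy⟩

theorem sum_smul_basisVec (v : Space n) : ∑ i, v i • (basisVec i : Space n) = v := by
  simpa only [basisVec, EuclideanSpace.basisFun_repr, EuclideanSpace.basisFun_apply] using
    (EuclideanSpace.basisFun (Fin n) ℝ).sum_repr v

theorem sum_basisVec_mul (k : Fin n) (c : Fin n → ℝ) :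
    ∑ i, (basisVec k : Space n) i * c i = c k := by
  simp [basisVec]

theorem hasDerivAt_add_smul (x v : Space n) (t : ℝ) : HasDerivAt (fun t : ℝ => x + t • v) v t := by
  simpa using ((hasDerivAt_id t).smul_const v).const_add x

theorem eventually_add_smul_mem (hU : IsOpen U) (hx : x ∈ U) (v : Space n) :
    ∀ᶠ t : ℝ in 𝓝 0, x + t • v ∈ U :=
  (hasDerivAt_add_smul x v 0).continuousAt.eventually_mem (hU.mem_nhds (by simpa using hx))

namespace IsSmoothOffZero

theorem congr (hf : IsSmoothOffZero U f) (h : ∀ x ∈ U, ∀ y, y ≠ 0 → g x y = f x y) :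
    IsSmoothOffZero U g :=
  ContDiffOn.congr hf fun p hp => h p.1 hp.1 p.2 hp.2

theorem add (hf : IsSmoothOffZero U f) (hg : IsSmoothOffZero U g) :
    IsSmoothOffZero U (fun x y => f x y + g x y) := ContDiffOn.add hf hg

theorem sub (hf : IsSmoothOffZero U f) (hg : IsSmoothOffZero U g) :
    IsSmoothOffZero U (fun x y => f x y - g x y) := ContDiffOn.sub hf hg

theorem mul (hf : IsSmoothOffZero U f) (hg : IsSmoothOffZero U g) :
    IsSmoothOffZero U (fun x y => f x y * g x y) := ContDiffOn.mul hf hg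

theorem pow (hf : IsSmoothOffZero U f) (k : ℕ) :
    IsSmoothOffZero U (fun x y => f x y ^ k) := ContDiffOn.pow hf k

theorem const_mul (hf : IsSmoothOffZero U f) (c : ℝ) :
    IsSmoothOffZero U (fun x y => c * f x y) := ContDiffOn.mul contDiffOn_const hf

theorem div (hf : IsSmoothOffZero U f) (hg : IsSmoothOffZero U g)
    (h0 : ∀ x ∈ U, ∀ y, y ≠ 0 → g x y ≠ 0) :
    IsSmoothOffZero U (fun x y => f x y / g x y) :=
  ContDiffOn.div hf hg fun p hp => h0 p.1 hp.1 p.2 hp.2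

theorem sum {ι : Type*} {s : Finset ι} {f : ι → Space n → Space n → ℝ}
    (hf : ∀ i ∈ s, IsSmoothOffZero U (f i)) :
    IsSmoothOffZero U (fun x y => ∑ i ∈ s, f i x y) := ContDiffOn.sum hf

theorem comp_neg (hf : IsSmoothOffZero U f) : IsSmoothOffZero U (fun x y => f x (-y)) :=
  ContDiffOn.comp hf (contDiff_fst.prodMk contDiff_snd.neg).contDiffOn fun _ hp =>
    ⟨hp.1, neg_ne_zero.2 hp.2⟩

theorem coord (U : Set (Space n)) (i : Fin n) : IsSmoothOffZero U (fun _ y => y i) :=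
  ((EuclideanSpace.proj (𝕜 := ℝ) i).contDiff.comp contDiff_snd).contDiffOn

section

variable (hf : IsSmoothOffZero U f) (hU : IsOpen U)
include hf hU

theorem fderiv_apply_const (w : Space n × Space n) :
    ContDiffOn ℝ ∞ (fun p : Space n × Space n =>
      fderiv ℝ (fun p : Space n × Space n => f p.1 p.2) p w) (U ×ˢ {0}ᶜ) :=
  (ContDiffOn.fderiv_of_isOpen hf (isOpen_slit hU) (by simp)).clm_apply contDiffOn_const

variable (hx : x ∈ U) (hy : y ≠ 0)
include hx hy

theorem contDiffAt : ContDiffAt ℝ ∞ (fun p : Space n × Space n => f p.1 p.2) (x, y) :=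
  ContDiffOn.contDiffAt hf (slit_mem_nhds hU hx hy)

theorem differentiableAt :
    DifferentiableAt ℝ (fun p : Space n × Space n => f p.1 p.2) (x, y) :=
  (hf.contDiffAt hU hx hy).differentiableAt (by simp)

theorem hasFDerivAt_fst : HasFDerivAt (fun z => f z y)
    ((fderiv ℝ (fun p : Space n × Space n => f p.1 p.2) (x, y)).comp
      (ContinuousLinearMap.inl ℝ (Space n) (Space n))) x :=
  (hf.differentiableAt hU hx hy).hasFDerivAt.comp (f := fun z => (z, y)) x
    (hasFDerivAt_prodMk_left x y)

theorem hasFDerivAt_snd : HasFDerivAt (fun v => f x v)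
    ((fderiv ℝ (fun p : Space n × Space n => f p.1 p.2) (x, y)).comp
      (ContinuousLinearMap.inr ℝ (Space n) (Space n))) y :=
  (hf.differentiableAt hU hx hy).hasFDerivAt.comp (f := fun v => (x, v)) y
    (hasFDerivAt_prodMk_right x y)

theorem differentiableAt_fst : DifferentiableAt ℝ (fun z => f z y) x :=
  (hf.hasFDerivAt_fst hU hx hy).differentiableAt

theorem differentiableAt_snd : DifferentiableAt ℝ (fun v => f x v) y :=
  (hf.hasFDerivAt_snd hU hx hy).differentiableAt

theorem partialX_eq_fderiv (i : Fin n) : Finsler.partialX i f x y =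
    fderiv ℝ (fun p : Space n × Space n => f p.1 p.2) (x, y) (basisVec i, 0) := by
  rw [Finsler.partialX, (hf.hasFDerivAt_fst hU hx hy).fderiv]
  rfl

theorem partialY_eq_fderiv (i : Fin n) : Finsler.partialY i f x y =
    fderiv ℝ (fun p : Space n × Space n => f p.1 p.2) (x, y) (0, basisVec i) := by
  rw [Finsler.partialY, (hf.hasFDerivAt_snd hU hx hy).fderiv]
  rfl

theorem fderiv_apply (u v : Space n) :
    fderiv ℝ (fun p : Space n × Space n => f p.1 p.2) (x, y) (u, v) =
      ∑ i, u i * Finsler.partialX i f x y + ∑ i, v i * Finsler.partialY i f x y := by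
  have huv : (u, v) = ∑ i, u i • ((basisVec i : Space n), (0 : Space n)) +
      ∑ i, v i • ((0 : Space n), (basisVec i : Space n)) := by
    ext1 <;> simp [Prod.fst_sum, Prod.snd_sum, sum_smul_basisVec]
  simp only [huv, map_add, map_sum, map_smul, smul_eq_mul, hf.partialX_eq_fderiv hU hx hy,
    hf.partialY_eq_fderiv hU hx hy]

end

section

variable (hf : IsSmoothOffZero U f) (hU : IsOpen U)
include hf hU

theorem partialX (i : Fin n) : IsSmoothOffZero U (partialX i f) :=
  (hf.fderiv_apply_const hU (basisVec i, 0)).congr fun _ hp => hf.partialX_eq_fderiv hU hp.1 hp.2 i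

theorem partialY (i : Fin n) : IsSmoothOffZero U (partialY i f) :=
  (hf.fderiv_apply_const hU (0, basisVec i)).congr fun _ hp => hf.partialY_eq_fderiv hU hp.1 hp.2 i

theorem flatSpray : IsSmoothOffZero U (flatSpray f) :=
  IsSmoothOffZero.sum fun j _ => (coord U j).mul (hf.partialX hU j)

theorem hasDerivAt_comp {β γ : ℝ → Space n} {β' γ' : Space n} {s : ℝ} (hβ : HasDerivAt β β' s)
    (hγ : HasDerivAt γ γ' s) (hx : β s ∈ U) (hy : γ s ≠ 0) :
    HasDerivAt (fun t => f (β t) (γ t)) (∑ i, β' i * Finsler.partialX i f (β s) (γ s) +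
      ∑ i, γ' i * Finsler.partialY i f (β s) (γ s)) s := by
  rw [← hf.fderiv_apply hU hx hy]
  exact (hf.differentiableAt hU hx hy).hasFDerivAt.comp_hasDerivAt (f := fun t => (β t, γ t)) s
    (hβ.prodMk hγ)

theorem hasDerivAt_flatSpray {t : ℝ} (hx : x + t • y ∈ U) (hy : y ≠ 0) :
    HasDerivAt (fun t => f (x + t • y) y) (Finsler.flatSpray f (x + t • y) y) t := by
  simpa [Finsler.flatSpray] using
    hf.hasDerivAt_comp hU (hasDerivAt_add_smul x y t) (hasDerivAt_const t y) hx hy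

end

end IsSmoothOffZero

section partials

theorem partialX_coord (i k : Fin n) : partialX i (fun _ y : Space n => y k) x y = 0 := by
  simp [partialX]

theorem partialY_coord (i k : Fin n) :
    partialY i (fun _ y : Space n => y k) x y = if k = i then 1 else 0 := by
  have hproj : fderiv ℝ (fun v : Space n => v k) y = EuclideanSpace.proj (𝕜 := ℝ) k :=
    (EuclideanSpace.proj (𝕜 := ℝ) k).hasFDerivAt.fderiv
  simp [partialY, hproj, basisVec]

theorem partialX_comp_neg (f : Space n → Space n → ℝ) (k : Fin n) (x y : Space n) :
    partialX k (fun x y => f x (-y)) x y = partialX k f x (-y) := rfl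

theorem partialY_comp_neg (f : Space n → Space n → ℝ) (k : Fin n) (x y : Space n) :
    partialY k (fun x y => f x (-y)) x y = -partialY k f x (-y) := by
  have h := (ContinuousLinearEquiv.neg ℝ (M := Space n)).comp_right_fderiv (f := f x) (x := y)
  simpa [partialY, Function.comp_def] using congrArg (fun T => T (basisVec k)) h

variable (hU : IsOpen U) (hx : x ∈ U) (hy : y ≠ 0)
include hU hx hy

theorem partialX_congr (h : ∀ x ∈ U, ∀ y, y ≠ 0 → f x y = g x y) (i : Fin n) :
    partialX i f x y = partialX i g x y := by
  have hfg : (fun z => f z y) =ᶠ[𝓝 x] fun z => g z y := by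
    filter_upwards [hU.mem_nhds hx] with z hz using h z hz y hy
  simp only [partialX, hfg.fderiv_eq]

omit hU in
theorem partialY_congr (h : ∀ x ∈ U, ∀ y, y ≠ 0 → f x y = g x y) (i : Fin n) :
    partialY i f x y = partialY i g x y := by
  have hfg : (fun v => f x v) =ᶠ[𝓝 y] fun v => g x v := by
    filter_upwards [isOpen_compl_singleton.mem_nhds hy] with v hv using h x hx v hv
  simp only [partialY, hfg.fderiv_eq]

section

variable (hf : IsSmoothOffZero U f)
include hf

theorem partialX_const_mul (c : ℝ) (i : Fin n) :
    partialX i (fun x y => c * f x y) x y = c * partialX i f x y := by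
  simp [partialX, fderiv_const_mul (hf.differentiableAt_fst hU hx hy)]

theorem partialY_const_mul (c : ℝ) (i : Fin n) :
    partialY i (fun x y => c * f x y) x y = c * partialY i f x y := by
  simp [partialY, fderiv_const_mul (hf.differentiableAt_snd hU hx hy)]

variable (hg : IsSmoothOffZero U g)
include hg

theorem partialX_add (i : Fin n) :
    partialX i (fun x y => f x y + g x y) x y = partialX i f x y + partialX i g x y := by
  simp [partialX, fderiv_fun_add (hf.differentiableAt_fst hU hx hy)
    (hg.differentiableAt_fst hU hx hy)]

theorem partialY_add (i : Fin n) :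
    partialY i (fun x y => f x y + g x y) x y = partialY i f x y + partialY i g x y := by
  simp [partialY, fderiv_fun_add (hf.differentiableAt_snd hU hx hy)
    (hg.differentiableAt_snd hU hx hy)]

theorem partialX_sub (i : Fin n) :
    partialX i (fun x y => f x y - g x y) x y = partialX i f x y - partialX i g x y := by
  simp [partialX, fderiv_fun_sub (hf.differentiableAt_fst hU hx hy)
    (hg.differentiableAt_fst hU hx hy)]

theorem partialY_sub (i : Fin n) :
    partialY i (fun x y => f x y - g x y) x y = partialY i f x y - partialY i g x y := by
  simp [partialY, fderiv_fun_sub (hf.differentiableAt_snd hU hx hy)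
    (hg.differentiableAt_snd hU hx hy)]

theorem partialX_mul (i : Fin n) : partialX i (fun x y => f x y * g x y) x y =
    f x y * partialX i g x y + partialX i f x y * g x y := by
  simp [partialX, fderiv_fun_mul (hf.differentiableAt_fst hU hx hy)
    (hg.differentiableAt_fst hU hx hy), mul_comm]

theorem partialY_mul (i : Fin n) : partialY i (fun x y => f x y * g x y) x y =
    f x y * partialY i g x y + partialY i f x y * g x y := by
  simp [partialY, fderiv_fun_mul (hf.differentiableAt_snd hU hx hy)
    (hg.differentiableAt_snd hU hx hy), mul_comm]

end

section

variable {ι : Type*} {s : Finset ι} {f : ι → Space n → Space n → ℝ}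
  (hf : ∀ i ∈ s, IsSmoothOffZero U (f i))
include hf

theorem partialX_sum (k : Fin n) :
    partialX k (fun x y => ∑ i ∈ s, f i x y) x y = ∑ i ∈ s, partialX k (f i) x y := by
  simp [partialX, fderiv_fun_sum fun i hi => (hf i hi).differentiableAt_fst hU hx hy]

theorem partialY_sum (k : Fin n) :
    partialY k (fun x y => ∑ i ∈ s, f i x y) x y = ∑ i ∈ s, partialY k (f i) x y := by
  simp [partialY, fderiv_fun_sum fun i hi => (hf i hi).differentiableAt_snd hU hx hy]

end

variable (hf : IsSmoothOffZero U f)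
include hf

theorem partialX_sq (i : Fin n) :
    partialX i (fun x y => f x y ^ 2) x y = 2 * f x y * partialX i f x y := by
  simp only [sq, partialX_mul hU hx hy hf hf]
  ring

theorem partialY_sq (i : Fin n) :
    partialY i (fun x y => f x y ^ 2) x y = 2 * f x y * partialY i f x y := by
  simp only [sq, partialY_mul hU hx hy hf hf]
  ring

theorem fderiv_fderiv_apply_comm (v w : Space n × Space n) :
    fderiv ℝ (fun p => fderiv ℝ (fun p : Space n × Space n => f p.1 p.2) p w) (x, y) v =
      fderiv ℝ (fun p => fderiv ℝ (fun p : Space n × Space n => f p.1 p.2) p v) (x, y) w := by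
  have hd : DifferentiableAt ℝ (fderiv ℝ (fun p : Space n × Space n => f p.1 p.2)) (x, y) :=
    ((hf.contDiffAt hU hx hy).fderiv_right (m := ∞) (by simp)).differentiableAt (by simp)
  have hsymm := (hf.contDiffAt hU hx hy).isSymmSndFDerivAt (by
    simpa using WithTop.coe_le_coe.2 (le_top : (2 : ℕ∞) ≤ ⊤))
  simpa [fderiv_clm_apply hd (differentiableAt_const _)] using hsymm v w

omit hf in
theorem partialX_eq_fderiv_of_eqOn (hg : IsSmoothOffZero U g) {h : Space n × Space n → ℝ}
    (hh : ∀ x ∈ U, ∀ y, y ≠ 0 → g x y = h (x, y)) (i : Fin n) :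
    partialX i g x y = fderiv ℝ h (x, y) (basisVec i, 0) := by
  rw [hg.partialX_eq_fderiv hU hx hy]
  congr 1
  refine EventuallyEq.fderiv_eq ?_
  filter_upwards [slit_mem_nhds hU hx hy] with p hp using hh p.1 hp.1 p.2 hp.2

omit hf in
theorem partialY_eq_fderiv_of_eqOn (hg : IsSmoothOffZero U g) {h : Space n × Space n → ℝ}
    (hh : ∀ x ∈ U, ∀ y, y ≠ 0 → g x y = h (x, y)) (i : Fin n) :
    partialY i g x y = fderiv ℝ h (x, y) (0, basisVec i) := by
  rw [hg.partialY_eq_fderiv hU hx hy]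
  congr 1
  refine EventuallyEq.fderiv_eq ?_
  filter_upwards [slit_mem_nhds hU hx hy] with p hp using hh p.1 hp.1 p.2 hp.2

theorem partialX_partialY_comm (i j : Fin n) :
    partialX i (partialY j f) x y = partialY j (partialX i f) x y := by
  rw [partialX_eq_fderiv_of_eqOn hU hx hy (hf.partialY hU j)
      (h := fun p => fderiv ℝ (fun p : Space n × Space n => f p.1 p.2) p (0, basisVec j))
      (fun _ hx _ hy => hf.partialY_eq_fderiv hU hx hy j),
    partialY_eq_fderiv_of_eqOn hU hx hy (hf.partialX hU i)
      (h := fun p => fderiv ℝ (fun p : Space n × Space n => f p.1 p.2) p (basisVec i, 0))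
      (fun _ hx _ hy => hf.partialX_eq_fderiv hU hx hy i), fderiv_fderiv_apply_comm hU hx hy hf]

theorem partialY_partialY_comm (i j : Fin n) :
    partialY i (partialY j f) x y = partialY j (partialY i f) x y := by
  have heq (i j : Fin n) : partialY i (partialY j f) x y =
      fderiv ℝ (fun p => fderiv ℝ (fun p : Space n × Space n => f p.1 p.2) p (0, basisVec j))
        (x, y) (0, basisVec i) :=
    partialY_eq_fderiv_of_eqOn hU hx hy (hf.partialY hU j)
      (fun _ hx _ hy => hf.partialY_eq_fderiv hU hx hy j) i
  rw [heq, heq, fderiv_fderiv_apply_comm hU hx hy hf]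

end partials

/-! ### The flat spray -/

section

variable (hU : IsOpen U) (hx : x ∈ U) (hy : y ≠ 0)
include hU hx hy

theorem flatSpray_congr (h : ∀ x ∈ U, ∀ y, y ≠ 0 → f x y = g x y) :
    flatSpray f x y = flatSpray g x y := by
  simp only [flatSpray, partialX_congr hU hx hy h]

variable (hf : IsSmoothOffZero U f)
include hf

theorem flatSpray_const_mul (c : ℝ) :
    flatSpray (fun x y => c * f x y) x y = c * flatSpray f x y := by
  simp only [flatSpray, partialX_const_mul hU hx hy hf, Finset.mul_sum, mul_left_comm]

theorem flatSpray_mul (hg : IsSmoothOffZero U g) :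
    flatSpray (fun x y => f x y * g x y) x y =
      f x y * flatSpray g x y + flatSpray f x y * g x y := by
  simp only [flatSpray, partialX_mul hU hx hy hf hg, mul_add, Finset.sum_add_distrib,
    Finset.mul_sum, Finset.sum_mul, mul_left_comm, mul_assoc]

theorem flatSpray_add (hg : IsSmoothOffZero U g) :
    flatSpray (fun x y => f x y + g x y) x y = flatSpray f x y + flatSpray g x y := by
  simp only [flatSpray, partialX_add hU hx hy hf hg, mul_add, Finset.sum_add_distrib]

theorem flatSpray_sq : flatSpray (fun x y => f x y ^ 2) x y = 2 * f x y * flatSpray f x y := by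
  simp only [flatSpray, partialX_sq hU hx hy hf, Finset.mul_sum, mul_left_comm]

theorem flatSpray_partialY (k : Fin n) :
    flatSpray (partialY k f) x y = partialY k (flatSpray f) x y - partialX k f x y := by
  have hterm (j : Fin n) := (IsSmoothOffZero.coord U j).mul (hf.partialX hU j)
  unfold flatSpray
  rw [partialY_sum hU hx hy fun j _ => hterm j]
  simp only [partialX_partialY_comm hU hx hy hf, partialY_mul hU hx hy
    (IsSmoothOffZero.coord U _) (hf.partialX hU _), partialY_coord, Finset.sum_add_distrib]
  simp

end

/-! ### Positive homogeneity -/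

/-- `f (x, y)` is positively homogeneous of degree `k` in `y ≠ 0`, for `x ∈ U`. -/
def IsHomogeneousOfDegree (U : Set (Space n)) (k : ℕ) (f : Space n → Space n → ℝ) : Prop :=
  ∀ x ∈ U, ∀ y, y ≠ 0 → ∀ c : ℝ, 0 < c → f x (c • y) = c ^ k * f x y

namespace IsHomogeneousOfDegree

variable {k : ℕ} (hf : IsHomogeneousOfDegree U k f) (hs : IsSmoothOffZero U f) (hU : IsOpen U)
include hf hs hU

theorem euler (hx : x ∈ U) (hy : y ≠ 0) : ∑ i, y i * Finsler.partialY i f x y = k * f x y := by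
  have hchain := hs.hasDerivAt_comp hU (hasDerivAt_const (1 : ℝ) x)
    ((hasDerivAt_id (1 : ℝ)).smul_const y) hx (by simpa using hy)
  have hpow : HasDerivAt (fun t : ℝ => f x (t • y)) (k * f x y) 1 := by
    refine (((hasDerivAt_pow k (1 : ℝ)).mul_const (f x y)).congr_of_eventuallyEq ?_).congr_deriv
      (by simp)
    filter_upwards [lt_mem_nhds (zero_lt_one (α := ℝ))] with t ht using hf x hx y hy t ht
  simpa using hchain.unique hpow

theorem partialX (i : Fin n) : IsHomogeneousOfDegree U k (partialX i f) := by
  intro x hx y hy c hc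
  have hloc : (fun z => f z (c • y)) =ᶠ[𝓝 x] fun z => c ^ k * f z y := by
    filter_upwards [hU.mem_nhds hx] with z hz using hf z hz y hy c hc
  simp [Finsler.partialX, hloc.fderiv_eq, fderiv_const_mul (hs.differentiableAt_fst hU hx hy)]

theorem flatSpray : IsHomogeneousOfDegree U (k + 1) (flatSpray f) := by
  intro x hx y hy c hc
  simp only [Finsler.flatSpray, hf.partialX hs hU _ x hx y hy c hc, Finset.mul_sum,
    PiLp.smul_apply, smul_eq_mul]
  exact Finset.sum_congr rfl fun _ _ => by ring

omit hf in
theorem partialY (hf : IsHomogeneousOfDegree U (k + 1) f) (i : Fin n) :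
    IsHomogeneousOfDegree U k (partialY i f) := by
  intro x hx y hy c hc
  have hloc : (fun v => f x (c • v)) =ᶠ[𝓝 y] fun v => c ^ (k + 1) * f x v := by
    filter_upwards [isOpen_compl_singleton.mem_nhds hy] with v hv using hf x hx v hv c hc
  have hscale : c * Finsler.partialY i f x (c • y) = c ^ (k + 1) * Finsler.partialY i f x y := by
    have h := congrArg (fun T => T (basisVec i)) (hloc.fderiv_eq (𝕜 := ℝ))
    rw [fderiv_const_mul (hs.differentiableAt_snd hU hx hy), fderiv_comp_smul] at h
    simpa [Finsler.partialY] using h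
  refine mul_left_cancel₀ hc.ne' (hscale.trans ?_)
  ring

end IsHomogeneousOfDegree

end

section

variable {n : ℕ} {U : Set (Space n)} {F P : Space n → Space n → ℝ} {x y : Space n}

/-! ### Metrics with straight geodesics -/

/-- The Lagrangian `F²` of the energy functional. -/
def lagrangian (F : Space n → Space n → ℝ) : Space n → Space n → ℝ := fun x y => F x y ^ 2

/-- The Euler–Lagrange expression of `F²` along a line traversed at constant speed:
`yʲ ∂²F²/∂xʲ∂yᵐ - ∂F²/∂xᵐ`, which is `4 g_mk Gᵏ`. -/
noncomputable def flatEulerLagrange (F : Space n → Space n → ℝ) (m : Fin n) (x y : Space n) : ℝ :=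
  flatSpray (partialY m (lagrangian F)) x y - partialX m (lagrangian F) x y

/-- `P` is the projective factor of `F`, that is, `Gᵏ = P yᵏ`. The condition is stated with the
index lowered by `g`, so that it involves neither `g` nor its inverse. -/
def IsProjectiveFactor (U : Set (Space n)) (F P : Space n → Space n → ℝ) : Prop :=
  ∀ x ∈ U, ∀ y, y ≠ 0 → ∀ m,
    flatEulerLagrange F m x y = 2 * P x y * partialY m (lagrangian F) x y

/-- The fundamental tensor as a bilinear form. -/
noncomputable def fundamentalBilin (F : Space n → Space n → ℝ) (x y : Space n) :
    LinearMap.BilinForm ℝ (Space n) :=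
  Matrix.toBilin (EuclideanSpace.basisFun (Fin n) ℝ).toBasis (fundamentalTensor F x y)

theorem fundamentalForm_eq_bilin (F : Space n → Space n → ℝ) (x y u v : Space n) :
    fundamentalForm F x y u v = fundamentalBilin F x y u v := by
  simp [fundamentalForm, fundamentalBilin, Matrix.toBilin_apply, mul_comm]

namespace IsStronglyConvex

variable (hF : IsStronglyConvex U F)
include hF

theorem isSmoothOffZero : IsSmoothOffZero U F := hF.smooth

theorem isSmoothOffZero_lagrangian : IsSmoothOffZero U (lagrangian F) :=
  hF.isSmoothOffZero.pow 2

theorem isHomogeneous : IsHomogeneousOfDegree U 1 F := fun x hx y _ c hc => by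
  rw [hF.smul x hx c hc.le y, pow_one]

theorem isHomogeneous_lagrangian : IsHomogeneousOfDegree U 2 (lagrangian F) :=
  fun x hx y _ c hc => by simp only [lagrangian, hF.smul x hx c hc.le y, mul_pow]

variable (hU : IsOpen U)
include hU

theorem isSmoothOffZero_fundamentalTensor (i j : Fin n) :
    IsSmoothOffZero U (fun x y => fundamentalTensor F x y i j) :=
  ((hF.isSmoothOffZero_lagrangian.partialY hU j).partialY hU i).const_mul _

theorem isSmoothOffZero_flatEulerLagrange (m : Fin n) :
    IsSmoothOffZero U (flatEulerLagrange F m) :=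
  ((hF.isSmoothOffZero_lagrangian.partialY hU m).flatSpray hU).sub
    (hF.isSmoothOffZero_lagrangian.partialX hU m)

variable (hx : x ∈ U) (hy : y ≠ 0)
include hx hy

theorem sum_mul_partialY_lagrangian :
    ∑ m, y m * partialY m (lagrangian F) x y = 2 * lagrangian F x y :=
  mod_cast hF.isHomogeneous_lagrangian.euler hF.isSmoothOffZero_lagrangian hU hx hy

theorem sum_mul_flatEulerLagrange :
    ∑ m, y m * flatEulerLagrange F m x y = flatSpray (lagrangian F) x y := by
  have hL := hF.isSmoothOffZero_lagrangian
  have heuler := (hF.isHomogeneous_lagrangian.flatSpray hL hU).euler (hL.flatSpray hU) hU hx hy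
  simp only [flatEulerLagrange, flatSpray_partialY hU hx hy hL, mul_sub,
    Finset.sum_sub_distrib, heuler]
  simp only [flatSpray]
  push_cast
  ring

theorem partialY_lagrangian (m : Fin n) :
    partialY m (lagrangian F) x y = 2 * F x y * partialY m F x y :=
  partialY_sq hU hx hy hF.isSmoothOffZero m

theorem fundamentalTensor_comm (i j : Fin n) :
    fundamentalTensor F x y i j = fundamentalTensor F x y j i :=
  congrArg _ (partialY_partialY_comm hU hx hy hF.isSmoothOffZero_lagrangian i j)

theorem sum_mul_fundamentalTensor (m : Fin n) :
    ∑ i, y i * fundamentalTensor F x y i m = 1 / 2 * partialY m (lagrangian F) x y := by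
  have heuler := (hF.isHomogeneous_lagrangian.partialY hF.isSmoothOffZero_lagrangian hU m).euler
    (hF.isSmoothOffZero_lagrangian.partialY hU m) hU hx hy
  rw [Nat.cast_one, one_mul] at heuler
  rw [← heuler, Finset.mul_sum]
  exact Finset.sum_congr rfl fun i _ => mul_left_comm _ _ _

theorem fundamentalTensor_mulVec_pole (m : Fin n) :
    (fundamentalTensor F x y).mulVec y.ofLp m = 1 / 2 * partialY m (lagrangian F) x y := by
  rw [← hF.sum_mul_fundamentalTensor hU hx hy m]
  simp only [Matrix.mulVec, dotProduct, mul_comm, hF.fundamentalTensor_comm hU hx hy m]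

theorem sum_mul_partialX_fundamentalTensor (j m : Fin n) :
    ∑ i, y i * partialX j (fun x y => fundamentalTensor F x y i m) x y =
      1 / 2 * partialX j (partialY m (lagrangian F)) x y := by
  have hg (i : Fin n) := hF.isSmoothOffZero_fundamentalTensor hU i m
  rw [← partialX_const_mul hU hx hy (hF.isSmoothOffZero_lagrangian.partialY hU m),
    ← partialX_congr hU hx hy (fun x hx y hy => hF.sum_mul_fundamentalTensor hU hx hy m),
    partialX_sum hU hx hy fun i _ => (IsSmoothOffZero.coord U i).mul (hg i)]
  simp [partialX_mul hU hx hy (IsSmoothOffZero.coord U _) (hg _), partialX_coord]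

theorem sum_mul_sum_mul_partialX_fundamentalTensor (m : Fin n) :
    ∑ j, y j * ∑ i, y i * partialX m (fun x y => fundamentalTensor F x y i j) x y =
      partialX m (lagrangian F) x y := by
  have heuler := (hF.isHomogeneous_lagrangian.partialX hF.isSmoothOffZero_lagrangian hU m).euler
    (hF.isSmoothOffZero_lagrangian.partialX hU m) hU hx hy
  simp only [hF.sum_mul_partialX_fundamentalTensor hU hx hy,
    partialX_partialY_comm hU hx hy hF.isSmoothOffZero_lagrangian, mul_left_comm _ (1 / 2 : ℝ),
    ← Finset.mul_sum, heuler]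
  ring

theorem sum_sum_christoffel_eq_flatEulerLagrange (m : Fin n) :
    ∑ i, ∑ j, y i * y j * (partialX j (fun x y => fundamentalTensor F x y i m) x y
      + partialX i (fun x y => fundamentalTensor F x y j m) x y
      - partialX m (fun x y => fundamentalTensor F x y i j) x y) = flatEulerLagrange F m x y := by
  have hij : ∑ i, ∑ j, y i * y j * partialX j (fun x y => fundamentalTensor F x y i m) x y =
      1 / 2 * flatSpray (partialY m (lagrangian F)) x y := by
    simp only [flatSpray, Finset.mul_sum, mul_left_comm (1 / 2 : ℝ),
      ← hF.sum_mul_partialX_fundamentalTensor hU hx hy]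
    rw [Finset.sum_comm]
    exact Finset.sum_congr rfl fun j _ => Finset.sum_congr rfl fun i _ => by ring
  have hji : ∑ i, ∑ j, y i * y j * partialX i (fun x y => fundamentalTensor F x y j m) x y =
      1 / 2 * flatSpray (partialY m (lagrangian F)) x y := by
    rw [← hij, Finset.sum_comm]
    simp only [mul_comm (y _) (y _)]
  have hm : ∑ i, ∑ j, y i * y j * partialX m (fun x y => fundamentalTensor F x y i j) x y =
      partialX m (lagrangian F) x y := by
    rw [← hF.sum_mul_sum_mul_partialX_fundamentalTensor hU hx hy m, Finset.sum_comm]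
    simp only [Finset.mul_sum, mul_assoc, mul_left_comm (y _) (y _)]
  simp only [mul_add, mul_sub, Finset.sum_add_distrib, Finset.sum_sub_distrib, hij, hji, hm,
    flatEulerLagrange]
  ring

theorem sprayCoeff_eq_mulVec (k : Fin n) : sprayCoeff F k x y =
    1 / 4 * (fundamentalTensor F x y)⁻¹.mulVec (fun m => flatEulerLagrange F m x y) k := by
  simp only [← hF.sum_sum_christoffel_eq_flatEulerLagrange hU hx hy, sprayCoeff,
    formalChristoffel, Matrix.mulVec, dotProduct, Finset.mul_sum, Finset.sum_mul]
  rw [Finset.sum_comm_cycle]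
  exact Finset.sum_congr rfl fun i _ => Finset.sum_congr rfl fun j _ =>
    Finset.sum_congr rfl fun m _ => by ring

end IsStronglyConvex

namespace IsProjectiveFactor

variable (h : IsProjectiveFactor U F P) (hF : IsStronglyConvex U F) (hU : IsOpen U)
include h hF hU

section

variable (hx : x ∈ U) (hy : y ≠ 0)
include hx hy

theorem sprayCoeff_eq (k : Fin n) : sprayCoeff F k x y = P x y * y k := by
  have hdet := (Matrix.isUnit_iff_isUnit_det _).1 (hF.posDef x hx y hy).isUnit
  have hlower : (fun m => flatEulerLagrange F m x y) =
      (4 * P x y) • (fundamentalTensor F x y).mulVec y.ofLp := by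
    ext m
    rw [h x hx y hy, Pi.smul_apply, hF.fundamentalTensor_mulVec_pole hU hx hy, smul_eq_mul]
    ring
  rw [hF.sprayCoeff_eq_mulVec hU hx hy, hlower, Matrix.mulVec_smul, Matrix.mulVec_mulVec,
    Matrix.nonsing_inv_mul _ hdet, Matrix.one_mulVec, Pi.smul_apply, smul_eq_mul]
  ring

theorem flatSpray_eq : flatSpray F x y = 2 * P x y * F x y := by
  have hEL : ∑ m, y m * flatEulerLagrange F m x y = 4 * P x y * lagrangian F x y := by
    simp only [h x hx y hy, mul_left_comm (y _), ← Finset.mul_sum,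
      hF.sum_mul_partialY_lagrangian hU hx hy]
    ring
  have hpos := hF.pos x hx y hy
  have hsq := (flatSpray_sq hU hx hy hF.isSmoothOffZero).symm.trans
    ((hF.sum_mul_flatEulerLagrange hU hx hy).symm.trans hEL)
  simp only [lagrangian] at hsq
  refine mul_left_cancel₀ (mul_pos two_pos hpos).ne' (hsq.trans ?_)
  ring

theorem eq_div : P x y = flatSpray F x y / (2 * F x y) := by
  have hpos := hF.pos x hx y hy
  rw [h.flatSpray_eq hF hU hx hy]
  field_simp

end

theorem isSmoothOffZero : IsSmoothOffZero U P :=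
  ((hF.isSmoothOffZero.flatSpray hU).div (hF.isSmoothOffZero.const_mul 2) fun x hx y hy =>
    (mul_pos two_pos (hF.pos x hx y hy)).ne').congr fun _ hx _ hy => h.eq_div hF hU hx hy

theorem isHomogeneous : IsHomogeneousOfDegree U 1 P := by
  intro x hx y hy c hc
  have hpos := hF.pos x hx y hy
  rw [h.eq_div hF hU hx hy, h.eq_div hF hU hx (smul_ne_zero hc.ne' hy),
    hF.isHomogeneous.flatSpray hF.isSmoothOffZero hU x hx y hy c hc, hF.smul x hx c hc.le]
  field_simp
  ring

theorem isSmoothOffZero_sprayCoeff (i : Fin n) : IsSmoothOffZero U (sprayCoeff F i) :=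
  ((h.isSmoothOffZero hF hU).mul (IsSmoothOffZero.coord U i)).congr fun _ hx _ hy =>
    h.sprayCoeff_eq hF hU hx hy i

theorem isHomogeneous_sprayCoeff (i : Fin n) : IsHomogeneousOfDegree U 2 (sprayCoeff F i) := by
  intro x hx y hy c hc
  rw [h.sprayCoeff_eq hF hU hx hy, h.sprayCoeff_eq hF hU hx (smul_ne_zero hc.ne' hy),
    h.isHomogeneous hF hU x hx y hy c hc, PiLp.smul_apply, smul_eq_mul]
  ring

variable (hx : x ∈ U) (hy : y ≠ 0)
include hx hy

theorem partialX_sprayCoeff (i k : Fin n) :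
    partialX k (sprayCoeff F i) x y = partialX k P x y * y i := by
  rw [partialX_congr hU hx hy fun x hx y hy => h.sprayCoeff_eq hF hU hx hy i,
    partialX_mul hU hx hy (h.isSmoothOffZero hF hU) (IsSmoothOffZero.coord U i), partialX_coord,
    mul_zero, zero_add]

theorem partialY_sprayCoeff (i k : Fin n) : partialY k (sprayCoeff F i) x y =
    (if i = k then 1 else 0) * P x y + partialY k P x y * y i := by
  rw [partialY_congr hx hy fun x hx y hy => h.sprayCoeff_eq hF hU hx hy i,
    partialY_mul hU hx hy (h.isSmoothOffZero hF hU) (IsSmoothOffZero.coord U i), partialY_coord,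
    mul_comm (P x y)]

theorem flatSpray_partialY_sprayCoeff (i k : Fin n) :
    flatSpray (partialY k (sprayCoeff F i)) x y =
      (if i = k then 1 else 0) * flatSpray P x y + flatSpray (partialY k P) x y * y i := by
  have hP := h.isSmoothOffZero hF hU
  have hcoord : flatSpray (fun _ y : Space n => y i) x y = 0 := by simp [flatSpray, partialX_coord]
  rw [flatSpray_congr hU hx hy fun x hx y hy => h.partialY_sprayCoeff hF hU hx hy i k,
    flatSpray_add hU hx hy (hP.const_mul _) ((hP.partialY hU k).mul (IsSmoothOffZero.coord U i)),
    flatSpray_const_mul hU hx hy hP,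
    flatSpray_mul hU hx hy (hP.partialY hU k) (IsSmoothOffZero.coord U i), hcoord, mul_zero,
    zero_add]

theorem sum_sprayCoeff_mul_partialY_partialY_sprayCoeff (i k : Fin n) :
    ∑ j, sprayCoeff F j x y * partialY j (partialY k (sprayCoeff F i)) x y =
      P x y * partialY k (sprayCoeff F i) x y := by
  have hG := h.isSmoothOffZero_sprayCoeff hF hU i
  have heuler := ((h.isHomogeneous_sprayCoeff hF hU i).partialY hG hU k).euler
    (hG.partialY hU k) hU hx hy
  rw [Nat.cast_one, one_mul] at heuler
  simp only [h.sprayCoeff_eq hF hU hx hy, mul_assoc, ← Finset.mul_sum, heuler]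

theorem sum_partialY_sprayCoeff_mul_partialY_sprayCoeff (i k : Fin n) :
    ∑ j, partialY j (sprayCoeff F i) x y * partialY k (sprayCoeff F j) x y =
      P x y ^ 2 * (if i = k then 1 else 0) + 3 * (P x y * partialY k P x y * y i) := by
  have heuler := (h.isHomogeneous hF hU).euler (h.isSmoothOffZero hF hU) hU hx hy
  rw [Nat.cast_one, one_mul] at heuler
  let N : Matrix (Fin n) (Fin n) ℝ :=
    P x y • 1 + Matrix.vecMulVec y.ofLp fun k => partialY k P x y
  have hN (i k : Fin n) : partialY k (sprayCoeff F i) x y = N i k := by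
    rw [h.partialY_sprayCoeff hF hU hx hy]
    simp [N, Matrix.one_apply, Matrix.vecMulVec_apply, mul_comm]
  have hsq : N * N = P x y ^ 2 • (1 : Matrix (Fin n) (Fin n) ℝ) +
      (3 * P x y) • Matrix.vecMulVec y.ofLp fun k => partialY k P x y := by
    have hdot : (fun k => partialY k P x y) ⬝ᵥ y.ofLp = P x y := by
      rw [dotProduct_comm]
      exact heuler
    simp only [N, add_mul, mul_add, smul_mul_assoc, mul_smul_comm, one_mul, mul_one,
      Matrix.vecMulVec_mul_vecMulVec, hdot, Matrix.vecMulVec_smul]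
    module
  simp only [hN, ← Matrix.mul_apply, hsq]
  simp [Matrix.one_apply, Matrix.vecMulVec_apply]
  ring

theorem riemannCurvature_eq : riemannCurvature F x y =
    (P x y ^ 2 - flatSpray P x y) • 1 + Matrix.vecMulVec y.ofLp fun k =>
      2 * partialX k P x y - flatSpray (partialY k P) x y - P x y * partialY k P x y := by
  ext i k
  have hS : ∑ j, partialX j (partialY k (sprayCoeff F i)) x y * y j =
      flatSpray (partialY k (sprayCoeff F i)) x y := by simp only [flatSpray, mul_comm]
  rw [riemannCurvature, Matrix.of_apply, hS, h.partialX_sprayCoeff hF hU hx hy,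
    h.flatSpray_partialY_sprayCoeff hF hU hx hy,
    h.sum_sprayCoeff_mul_partialY_partialY_sprayCoeff hF hU hx hy,
    h.sum_partialY_sprayCoeff_mul_partialY_sprayCoeff hF hU hx hy,
    h.partialY_sprayCoeff hF hU hx hy]
  simp only [Matrix.add_apply, Matrix.smul_apply, Matrix.one_apply, Matrix.vecMulVec_apply,
    smul_eq_mul]
  ring

end IsProjectiveFactor

/-! ### Flag curvature of metrics with straight geodesics -/

theorem flagCurvature_eq_of_riemannCurvature_eq {w : Space n} {κ : ℝ} {τ : Fin n → ℝ}
    (hR : riemannCurvature F x y = κ • 1 + Matrix.vecMulVec y.ofLp τ) :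
    flagCurvature F x y w =
      (κ * fundamentalForm F x y w w + (∑ k, τ k * w k) * fundamentalForm F x y y w) /
        (F x y ^ 2 * fundamentalForm F x y w w - fundamentalForm F x y w y ^ 2) := by
  have hRw : (WithLp.toLp 2 fun i => ∑ k, riemannCurvature F x y i k * w k : Space n) =
      κ • w + (∑ k, τ k * w k) • y := by
    ext i
    simp [hR, Matrix.one_apply, Matrix.vecMulVec_apply, add_mul, Finset.sum_add_distrib,
      Finset.sum_mul, mul_right_comm, mul_comm (y i)]
  simp only [flagCurvature, hRw, fundamentalForm_eq_bilin, map_add, map_smul,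
    LinearMap.add_apply, LinearMap.smul_apply, smul_eq_mul]

namespace IsStronglyConvex

variable (hF : IsStronglyConvex U F) (hx : x ∈ U) (hy : y ≠ 0)
include hF hx hy

theorem fundamentalBilin_self_pos {u : Space n} (hu : u ≠ 0) : 0 < fundamentalBilin F x y u u := by
  have hpos := (hF.posDef x hx y hy).dotProduct_mulVec_pos (x := u.ofLp) (by simpa using hu)
  simpa [fundamentalBilin, Matrix.toBilin_apply, dotProduct, Matrix.mulVec, Finset.mul_sum,
    mul_assoc] using hpos

theorem exists_fundamentalForm_eq_zero (hn : 2 ≤ n) :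
    ∃ w : Space n, LinearIndependent ℝ ![y, w] ∧ fundamentalForm F x y w y = 0 := by
  obtain ⟨v, hv⟩ := exists_linearIndependent_pair_of_one_lt_finrank
    (R := ℝ) (by simpa using Nat.lt_of_succ_le hn) hy
  have hyy := hF.fundamentalBilin_self_pos hx hy hy
  refine ⟨(-(fundamentalBilin F x y v y / fundamentalBilin F x y y y)) • y + v,
    (LinearIndependent.pair_add_smul_right_iff _).2 hv, ?_⟩
  simp only [fundamentalForm_eq_bilin, map_add, map_smul, LinearMap.add_apply,
    LinearMap.smul_apply, smul_eq_mul]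
  field_simp
  ring

variable (hU : IsOpen U)
include hU

theorem fundamentalBilin_isSymm : LinearMap.IsSymm (fundamentalBilin F x y) := by
  refine ⟨fun u v => ?_⟩
  simp only [RingHom.id_apply, ← fundamentalForm_eq_bilin, fundamentalForm]
  rw [Finset.sum_comm]
  exact Finset.sum_congr rfl fun i _ => Finset.sum_congr rfl fun j _ => by
    rw [hF.fundamentalTensor_comm hU hx hy, mul_right_comm]

theorem fundamentalForm_comm (u v : Space n) :
    fundamentalForm F x y u v = fundamentalForm F x y v u := by
  simpa only [fundamentalForm_eq_bilin, RingHom.id_apply] using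
    (hF.fundamentalBilin_isSymm hx hy hU).eq u v

theorem fundamentalForm_pole_left (w : Space n) :
    fundamentalForm F x y y w = F x y * ∑ k, partialY k F x y * w k := by
  have hpole (k : Fin n) : ∑ i, fundamentalTensor F x y i k * y i = F x y * partialY k F x y := by
    simp only [mul_comm _ (y _), hF.sum_mul_fundamentalTensor hU hx hy,
      hF.partialY_lagrangian hU hx hy]
    ring
  rw [fundamentalForm, Finset.sum_comm]
  simp only [← Finset.sum_mul, hpole]
  simp only [mul_assoc, Finset.mul_sum]

theorem fundamentalForm_pole_pole : fundamentalForm F x y y y = F x y ^ 2 := by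
  have heuler := hF.isHomogeneous.euler hF.isSmoothOffZero hU hx hy
  simp only [hF.fundamentalForm_pole_left hx hy hU, mul_comm _ (y _), heuler]
  ring

theorem fundamentalForm_sq_lt {w : Space n} (hw : LinearIndependent ℝ ![y, w]) :
    fundamentalForm F x y w y ^ 2 < F x y ^ 2 * fundamentalForm F x y w w := by
  rw [← hF.fundamentalForm_pole_pole hx hy hU, hF.fundamentalForm_comm hx hy hU w y]
  simpa only [fundamentalForm_eq_bilin] using
    (LinearMap.BilinForm.apply_sq_lt_iff_linearIndependent_of_symm (fundamentalBilin F x y)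
      (fun _ => hF.fundamentalBilin_self_pos hx hy) (hF.fundamentalBilin_isSymm hx hy hU) y w).2 hw

end IsStronglyConvex

namespace IsProjectiveFactor

variable (h : IsProjectiveFactor U F P) (hF : IsStronglyConvex U F) (hU : IsOpen U)
include h hF hU

theorem flatSpray_of_flagCurvature (hn : 2 ≤ n) (hK : HasConstantFlagCurvature U F (-1))
    (hx : x ∈ U) (hy : y ≠ 0) : flatSpray P x y = P x y ^ 2 + F x y ^ 2 := by
  obtain ⟨w, hw, hwy⟩ := hF.exists_fundamentalForm_eq_zero hx hy hn
  have hww : 0 < fundamentalForm F x y w w := by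
    rw [fundamentalForm_eq_bilin]
    exact hF.fundamentalBilin_self_pos hx hy (hw.ne_zero 1)
  have hpos := hF.pos x hx y hy
  have hK' := hK x hx y w hw
  rw [flagCurvature_eq_of_riemannCurvature_eq (h.riemannCurvature_eq hF hU hx hy),
    hF.fundamentalForm_comm hx hy hU y w, hwy, mul_zero, add_zero, zero_pow two_ne_zero,
    sub_zero, mul_div_mul_right _ _ hww.ne', div_eq_iff (pow_pos hpos 2).ne'] at hK'
  linarith

theorem hasConstantFlagCurvature_neg_one
    (hS : ∀ x ∈ U, ∀ y, y ≠ 0 → flatSpray P x y = P x y ^ 2 + F x y ^ 2)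
    (hτ : ∀ x ∈ U, ∀ y, y ≠ 0 → ∀ k, 2 * partialX k P x y - flatSpray (partialY k P) x y
      - P x y * partialY k P x y = F x y * partialY k F x y) :
    HasConstantFlagCurvature U F (-1) := by
  intro x hx y w hw
  have hy : y ≠ 0 := hw.ne_zero 0
  rw [flagCurvature_eq_of_riemannCurvature_eq (h.riemannCurvature_eq hF hU hx hy),
    div_eq_iff (sub_pos.2 (hF.fundamentalForm_sq_lt hx hy hU hw)).ne', hS x hx y hy]
  simp only [hτ x hx y hy, mul_assoc, ← Finset.mul_sum,
    ← hF.fundamentalForm_pole_left hx hy hU, hF.fundamentalForm_comm hx hy hU w y]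
  ring

end IsProjectiveFactor

end

section

variable {n : ℕ} {U : Set (Space n)} {x y : Space n}

/-! ### The Funk metric -/

theorem funkMetric_eq_gauge (U : Set (Space n)) (x ξ : Space n) :
    funkMetric U x ξ = gauge ((fun v => x + v) ⁻¹' U) ξ := by
  rw [gauge_def']
  rfl

theorem funkMetric_nonneg (U : Set (Space n)) (x ξ : Space n) : 0 ≤ funkMetric U x ξ := by
  rw [funkMetric_eq_gauge]
  exact gauge_nonneg _

theorem funkMetric_smul (U : Set (Space n)) (x ξ : Space n) {c : ℝ} (hc : 0 ≤ c) :
    funkMetric U x (c • ξ) = c * funkMetric U x ξ := by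
  rw [funkMetric_eq_gauge, funkMetric_eq_gauge, gauge_smul_of_nonneg hc, smul_eq_mul]

theorem isHomogeneous_funkMetric (U : Set (Space n)) :
    IsHomogeneousOfDegree U 1 (funkMetric U) := fun x _ y _ c hc => by
  rw [funkMetric_smul U x y hc.le, pow_one]

section

variable (hU : IsOpen U) (hx : x ∈ U)
include hU hx

theorem translate_mem_nhds : (fun v => x + v) ⁻¹' U ∈ 𝓝 (0 : Space n) :=
  (hU.preimage (continuous_const_add x)).mem_nhds (by simpa using hx)

theorem funkMetric_pos (hbdd : Bornology.IsBounded U) (hy : y ≠ 0) : 0 < funkMetric U x y := by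
  have hbdd' : Bornology.IsBounded ((fun v => x + v) ⁻¹' U) := by
    simpa [← Set.image_vadd] using hbdd.vadd (-x)
  rw [funkMetric_eq_gauge, gauge_pos (absorbent_nhds_zero (translate_mem_nhds hU hx))
    ((NormedSpace.isVonNBounded_iff ℝ).2 hbdd')]
  exact hy

variable (hconv : Convex ℝ U)
include hconv

theorem funkMetric_lt_one_iff {v : Space n} : funkMetric U x v < 1 ↔ x + v ∈ U := by
  rw [funkMetric_eq_gauge, gauge_lt_one_iff_mem_interior (hconv.translate_preimage_right x)
    (translate_mem_nhds hU hx), (hU.preimage (continuous_const_add x)).interior_eq]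
  rfl

theorem funkMetric_eq_one_iff {v : Space n} : funkMetric U x v = 1 ↔ x + v ∈ frontier U := by
  rw [funkMetric_eq_gauge, gauge_eq_one_iff_mem_frontier (hconv.translate_preimage_right x)
    (translate_mem_nhds hU hx)]
  exact Set.ext_iff.1 ((Homeomorph.addLeft x).preimage_frontier U).symm v

theorem add_smul_mem_iff {t : ℝ} (ht : 0 ≤ t) : x + t • y ∈ U ↔ t * funkMetric U x y < 1 := by
  rw [← funkMetric_lt_one_iff hU hx hconv, funkMetric_smul U x y ht]

theorem mul_funkMetric_lt_one {t : ℝ} (ht : x + t • y ∈ U) : t * funkMetric U x y < 1 := by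
  rcases le_or_gt 0 t with h | h
  · exact (add_smul_mem_iff hU hx hconv h).1 ht
  · exact (mul_nonpos_of_nonpos_of_nonneg h.le (funkMetric_nonneg U x y)).trans_lt one_pos

theorem add_inv_funkMetric_smul_mem_frontier (hpos : 0 < funkMetric U x y) :
    x + (funkMetric U x y)⁻¹ • y ∈ frontier U := by
  rw [← funkMetric_eq_one_iff hU hx hconv, funkMetric_smul _ _ _ (inv_nonneg.2 hpos.le),
    inv_mul_cancel₀ hpos.ne']

theorem funkMetric_add_smul (hpos : 0 < funkMetric U x y) {t : ℝ} (ht : x + t • y ∈ U) :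
    funkMetric U (x + t • y) y = funkMetric U x y / (1 - t * funkMetric U x y) := by
  have htpos := mul_funkMetric_lt_one hU hx hconv ht
  have hend := add_inv_funkMetric_smul_mem_frontier hU hx hconv hpos
  set α := funkMetric U x y
  have hle : 0 ≤ α⁻¹ - t := by
    rw [sub_nonneg, ← one_div, le_div_iff₀ hpos]
    exact htpos.le
  have hone : (α⁻¹ - t) * funkMetric U (x + t • y) y = 1 := by
    rw [← funkMetric_smul _ _ _ hle, funkMetric_eq_one_iff hU ht hconv]
    convert hend using 1
    module
  rw [eq_div_iff (sub_pos.2 htpos).ne']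
  calc _ = α * ((α⁻¹ - t) * funkMetric U (x + t • y) y) := by field_simp
    _ = _ := by rw [hone, mul_one]

theorem hasDerivAt_funkMetric_add_smul (hpos : 0 < funkMetric U x y) :
    HasDerivAt (fun t : ℝ => funkMetric U (x + t • y) y) (funkMetric U x y ^ 2) 0 := by
  have hden : HasDerivAt (fun t : ℝ => 1 - t * funkMetric U x y) (-funkMetric U x y) 0 := by
    simpa using ((hasDerivAt_id (0 : ℝ)).mul_const (funkMetric U x y)).const_sub 1
  have hquot := (hasDerivAt_const (0 : ℝ) (funkMetric U x y)).fun_div hden (by simp)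
  refine (hquot.congr_deriv (by simp [sq])).congr_of_eventuallyEq ?_
  filter_upwards [eventually_add_smul_mem hU hx y] with t ht
  exact funkMetric_add_smul hU hx hconv hpos ht

theorem hasDerivAt_funkMetric_add_smul_neg (hpos : 0 < funkMetric U x (-y)) :
    HasDerivAt (fun t : ℝ => funkMetric U (x + t • y) (-y)) (-funkMetric U x (-y) ^ 2) 0 := by
  have h := HasDerivAt.scomp (0 : ℝ) (h := fun t : ℝ => -t)
    (by simpa using hasDerivAt_funkMetric_add_smul hU hx hconv hpos) (hasDerivAt_neg (0 : ℝ))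
  simpa [Function.comp_def, smul_neg] using h

/-- **Okada's equation**. -/
theorem partialX_funkMetric (hs : IsSmoothOffZero U (funkMetric U)) (hy : y ≠ 0)
    (hpos : 0 < funkMetric U x y) (k : Fin n) :
    partialX k (funkMetric U) x y = funkMetric U x y * partialY k (funkMetric U) x y := by
  have hhom := isHomogeneous_funkMetric U
  have hend := add_inv_funkMetric_smul_mem_frontier hU hx hconv hpos
  set α := funkMetric U x y
  have hv : α⁻¹ • y ≠ 0 := smul_ne_zero (inv_ne_zero hpos.ne') hy
  -- The frontier point `x + α⁻¹ y` stays put while the base point moves along the `k`-th axis.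
  have hone : (fun t : ℝ => funkMetric U (x + t • (basisVec k : Space n))
      (α⁻¹ • y + t • -(basisVec k : Space n))) =ᶠ[𝓝 0] fun _ => 1 := by
    filter_upwards [eventually_add_smul_mem hU hx (basisVec k)] with t ht
    rw [funkMetric_eq_one_iff hU ht hconv]
    convert hend using 1
    module
  have hderiv := (hs.hasDerivAt_comp hU (hasDerivAt_add_smul x (basisVec k) 0)
    (hasDerivAt_add_smul (α⁻¹ • y) (-basisVec k) 0) (by simpa using hx) (by simpa using hv)).unique
    ((hasDerivAt_const (0 : ℝ) (1 : ℝ)).congr_of_eventuallyEq hone)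
  simp only [zero_smul, add_zero, PiLp.neg_apply, neg_mul, Finset.sum_neg_distrib,
    sum_basisVec_mul, hhom.partialX hs hU k x hx y hy _ (inv_pos.2 hpos),
    hhom.partialY hs hU k x hx y hy _ (inv_pos.2 hpos)] at hderiv
  field_simp at hderiv
  linarith

end

/-! ### Berwald's system -/

/-- Berwald's system of partial differential equations, which characterizes the metrics `F` with
projective factor `P` and constant flag curvature `-1`. -/
structure IsBerwaldPair (U : Set (Space n)) (F P : Space n → Space n → ℝ) : Prop where
  isSmoothOffZero_factor : IsSmoothOffZero U P
  isHomogeneous_factor : IsHomogeneousOfDegree U 1 P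
  partialX_metric : ∀ x ∈ U, ∀ y, y ≠ 0 → ∀ k,
    partialX k F x y = P x y * partialY k F x y + partialY k P x y * F x y
  partialX_factor : ∀ x ∈ U, ∀ y, y ≠ 0 → ∀ k,
    partialX k P x y = P x y * partialY k P x y + F x y * partialY k F x y

namespace IsBerwaldPair

variable {F P : Space n → Space n → ℝ} (h : IsBerwaldPair U F P) (hU : IsOpen U)
include h hU

theorem congr_metric {F' : Space n → Space n → ℝ}
    (hF' : ∀ x ∈ U, ∀ y, y ≠ 0 → F' x y = F x y) : IsBerwaldPair U F' P where
  isSmoothOffZero_factor := h.isSmoothOffZero_factor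
  isHomogeneous_factor := h.isHomogeneous_factor
  partialX_metric x hx y hy k := by
    rw [partialX_congr hU hx hy hF', partialY_congr hx hy hF', hF' x hx y hy,
      h.partialX_metric x hx y hy]
  partialX_factor x hx y hy k := by
    rw [partialY_congr hx hy hF', hF' x hx y hy, h.partialX_factor x hx y hy]

variable (hF : IsStronglyConvex U F)
include hF

section

variable (hx : x ∈ U) (hy : y ≠ 0)
include hx hy

theorem flatSpray_metric : flatSpray F x y = 2 * P x y * F x y := by
  have heulerF := hF.isHomogeneous.euler hF.isSmoothOffZero hU hx hy
  have heulerP := h.isHomogeneous_factor.euler h.isSmoothOffZero_factor hU hx hy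
  calc flatSpray F x y = P x y * ∑ k, y k * partialY k F x y +
        (∑ k, y k * partialY k P x y) * F x y := by
        simp only [flatSpray, h.partialX_metric x hx y hy, Finset.mul_sum, Finset.sum_mul,
          ← Finset.sum_add_distrib]
        exact Finset.sum_congr rfl fun k _ => by ring
    _ = 2 * P x y * F x y := by
        rw [heulerF, heulerP]
        ring

theorem flatSpray_factor : flatSpray P x y = P x y ^ 2 + F x y ^ 2 := by
  have heulerF := hF.isHomogeneous.euler hF.isSmoothOffZero hU hx hy
  have heulerP := h.isHomogeneous_factor.euler h.isSmoothOffZero_factor hU hx hy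
  calc flatSpray P x y = P x y * ∑ k, y k * partialY k P x y +
        F x y * ∑ k, y k * partialY k F x y := by
        simp only [flatSpray, h.partialX_factor x hx y hy, Finset.mul_sum,
          ← Finset.sum_add_distrib]
        exact Finset.sum_congr rfl fun k _ => by ring
    _ = P x y ^ 2 + F x y ^ 2 := by
        rw [heulerF, heulerP]
        ring

end

theorem isProjectiveFactor : IsProjectiveFactor U F P := by
  intro x hx y hy m
  have hs := hF.isSmoothOffZero
  have hP := h.isSmoothOffZero_factor
  have hSL : ∀ x ∈ U, ∀ y, y ≠ 0 →
      flatSpray (lagrangian F) x y = 4 * (P x y * lagrangian F x y) := fun x hx y hy => by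
    unfold lagrangian
    rw [flatSpray_sq hU hx hy hs, h.flatSpray_metric hU hF hx hy]
    ring
  have hxL : partialX m (lagrangian F) x y = 2 * F x y * partialX m F x y :=
    partialX_sq hU hx hy hs m
  rw [flatEulerLagrange, flatSpray_partialY hU hx hy hF.isSmoothOffZero_lagrangian,
    partialY_congr hx hy hSL, partialY_const_mul hU hx hy (hP.mul hF.isSmoothOffZero_lagrangian),
    partialY_mul hU hx hy hP hF.isSmoothOffZero_lagrangian, hF.partialY_lagrangian hU hx hy,
    hxL, h.partialX_metric x hx y hy, lagrangian]
  ring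

theorem hasConstantFlagCurvature : HasConstantFlagCurvature U F (-1) := by
  refine (h.isProjectiveFactor hU hF).hasConstantFlagCurvature_neg_one hF hU
    (fun x hx y hy => h.flatSpray_factor hU hF hx hy) fun x hx y hy k => ?_
  have hs := hF.isSmoothOffZero
  have hP := h.isSmoothOffZero_factor
  rw [flatSpray_partialY hU hx hy hP,
    partialY_congr hx hy fun x hx y hy => h.flatSpray_factor hU hF hx hy,
    partialY_add hU hx hy (hP.pow 2) (hs.pow 2), partialY_sq hU hx hy hP, partialY_sq hU hx hy hs,
    h.partialX_factor x hx y hy]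
  ring

end IsBerwaldPair

/-! ### Spray and curvature of the Hilbert metric -/

/-- The projective factor of the Hilbert metric, half the difference of the Funk metric and its
reverse. -/
noncomputable def hilbertFactor (U : Set (Space n)) (x y : Space n) : ℝ :=
  1 / 2 * (funkMetric U x y - funkMetric U x (-y))

theorem isHomogeneous_hilbertFactor (U : Set (Space n)) :
    IsHomogeneousOfDegree U 1 (hilbertFactor U) := fun x hx y hy c hc => by
  have hhom := isHomogeneous_funkMetric U x hx
  rw [hilbertFactor, ← smul_neg, hhom y hy c hc, hhom (-y) (neg_ne_zero.2 hy) c hc, hilbertFactor]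
  ring

section

variable (hU : IsOpen U) (hA : IsSmoothOffZero U (funkMetric U)) (hx : x ∈ U) (hy : y ≠ 0)
include hU hA hx hy

theorem partialY_hilbertMetric (k : Fin n) : partialY k (hilbertMetric U) x y =
    1 / 2 * (partialY k (funkMetric U) x y - partialY k (funkMetric U) x (-y)) := by
  unfold hilbertMetric
  rw [partialY_const_mul hU hx hy (hA.add hA.comp_neg), partialY_add hU hx hy hA hA.comp_neg,
    partialY_comp_neg, ← sub_eq_add_neg]

theorem partialY_hilbertFactor (k : Fin n) : partialY k (hilbertFactor U) x y =
    1 / 2 * (partialY k (funkMetric U) x y + partialY k (funkMetric U) x (-y)) := by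
  unfold hilbertFactor
  rw [partialY_const_mul hU hx hy (hA.sub hA.comp_neg), partialY_sub hU hx hy hA hA.comp_neg,
    partialY_comp_neg, sub_neg_eq_add]

theorem partialX_hilbertMetric (k : Fin n) : partialX k (hilbertMetric U) x y =
    1 / 2 * (partialX k (funkMetric U) x y + partialX k (funkMetric U) x (-y)) := by
  unfold hilbertMetric
  rw [partialX_const_mul hU hx hy (hA.add hA.comp_neg), partialX_add hU hx hy hA hA.comp_neg,
    partialX_comp_neg]

theorem partialX_hilbertFactor (k : Fin n) : partialX k (hilbertFactor U) x y =
    1 / 2 * (partialX k (funkMetric U) x y - partialX k (funkMetric U) x (-y)) := by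
  unfold hilbertFactor
  rw [partialX_const_mul hU hx hy (hA.sub hA.comp_neg), partialX_sub hU hx hy hA hA.comp_neg,
    partialX_comp_neg]

end

theorem isBerwaldPair_hilbertMetric (hU : IsOpen U) (hconv : Convex ℝ U)
    (hbdd : Bornology.IsBounded U) (hA : IsSmoothOffZero U (funkMetric U)) :
    IsBerwaldPair U (hilbertMetric U) (hilbertFactor U) := by
  have okada (x) (hx : x ∈ U) (y) (hy : y ≠ 0) :=
    partialX_funkMetric hU hx hconv hA hy (funkMetric_pos hU hx hbdd hy)
  refine ⟨(hA.sub hA.comp_neg).const_mul _, isHomogeneous_hilbertFactor U,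
    fun x hx y hy k => ?_, fun x hx y hy k => ?_⟩
  · rw [partialX_hilbertMetric hU hA hx hy, okada x hx y hy, okada x hx (-y) (neg_ne_zero.2 hy),
      partialY_hilbertMetric hU hA hx hy, partialY_hilbertFactor hU hA hx hy, hilbertMetric,
      hilbertFactor]
    ring
  · rw [partialX_hilbertFactor hU hA hx hy, okada x hx y hy, okada x hx (-y) (neg_ne_zero.2 hy),
      partialY_hilbertMetric hU hA hx hy, partialY_hilbertFactor hU hA hx hy, hilbertMetric,
      hilbertFactor]
    ring

namespace IsStronglyConvex

variable {F : Space n → Space n → ℝ} (hF : IsStronglyConvex U F) (hU : IsOpen U)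
  (hconv : Convex ℝ U) (hbdd : Bornology.IsBounded U)
  (hH : ∀ x ∈ U, ∀ ξ : Space n, F x ξ = hilbertMetric U x ξ)
include hF hU hconv hbdd hH

theorem flatSpray_of_hilbert (hx : x ∈ U) (hy : y ≠ 0) :
    flatSpray F x y = 2 * hilbertFactor U x y * F x y := by
  have hflat := hF.isSmoothOffZero.hasDerivAt_flatSpray hU (t := 0) (by simpa using hx) hy
  rw [zero_smul, add_zero] at hflat
  have hfunk := ((hasDerivAt_funkMetric_add_smul hU hx hconv (funkMetric_pos hU hx hbdd hy)).fun_add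
    (hasDerivAt_funkMetric_add_smul_neg hU hx hconv
      (funkMetric_pos hU hx hbdd (neg_ne_zero.2 hy)))).const_mul (1 / 2)
  have heq : (fun t : ℝ => F (x + t • y) y) =ᶠ[𝓝 0]
      fun t => 1 / 2 * (funkMetric U (x + t • y) y + funkMetric U (x + t • y) (-y)) := by
    filter_upwards [eventually_add_smul_mem hU hx y] with t ht
    exact hH _ ht y
  rw [hflat.unique (hfunk.congr_of_eventuallyEq heq), hH x hx, hilbertFactor, hilbertMetric]
  ring

theorem isSmoothOffZero_hilbertFactor : IsSmoothOffZero U (hilbertFactor U) := by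
  have hpos := hF.pos
  refine ((hF.isSmoothOffZero.flatSpray hU).div (hF.isSmoothOffZero.const_mul 2)
    fun x hx y hy => (mul_pos two_pos (hpos x hx y hy)).ne').congr fun x hx y hy => ?_
  rw [hF.flatSpray_of_hilbert hU hconv hbdd hH hx hy]
  field_simp [(hpos x hx y hy).ne']

theorem isSmoothOffZero_funkMetric : IsSmoothOffZero U (funkMetric U) :=
  (hF.isSmoothOffZero.add (hF.isSmoothOffZero_hilbertFactor hU hconv hbdd hH)).congr
    fun x hx y _ => by
      rw [hH x hx, hilbertMetric, hilbertFactor]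
      ring

theorem isBerwaldPair_of_hilbert : IsBerwaldPair U F (hilbertFactor U) :=
  (isBerwaldPair_hilbertMetric hU hconv hbdd
    (hF.isSmoothOffZero_funkMetric hU hconv hbdd hH)).congr_metric hU fun x hx y _ => hH x hx y

end IsStronglyConvex

end

/-! ### First variation -/

section

variable {E : Type*} [NormedAddCommGroup E] [NormedSpace ℝ E] {W O : Set E} {Φ : E → ℝ}
  {γ δ : ℝ → E} {K : Set ℝ} {a b : ℝ}

theorem exists_cthickening_curve_subset (hO : IsOpen O) (hK : IsCompact K)
    (hγ : ContinuousOn γ K) (hδ : ContinuousOn δ K) (hmem : MapsTo γ K O) :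
    ∃ ρ > 0, Metric.cthickening ρ (γ '' K) ⊆ O ∧ ∃ r > 0, ∀ ε ∈ Metric.ball (0 : ℝ) r, ∀ s ∈ K,
      γ s + ε • δ s ∈ Metric.cthickening ρ (γ '' K) := by
  obtain ⟨ρ, hρ, hsub⟩ := (hK.image_of_continuousOn hγ).exists_cthickening_subset_open
    hO hmem.image_subset
  obtain ⟨M, hM⟩ := hK.exists_bound_of_continuousOn hδ
  refine ⟨ρ, hρ, hsub, ρ / (|M| + 1), by positivity, fun ε hε s hs => ?_⟩
  refine Metric.mem_cthickening_of_dist_le _ (γ s) _ _ (mem_image_of_mem _ hs) ?_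
  rw [mem_ball_zero_iff, lt_div_iff₀ (by positivity)] at hε
  rw [dist_eq_norm, add_sub_cancel_left, norm_smul]
  refine le_trans ?_ hε.le
  gcongr
  exact ((hM s hs).trans (le_abs_self M)).trans (by linarith)

theorem exists_norm_fderiv_variation_le [ProperSpace E] (hO : IsOpen O)
    (hΦ : ContinuousOn (fderiv ℝ Φ) O) (hK : IsCompact K) (hγ : ContinuousOn γ K)
    (hδ : ContinuousOn δ K) (hmem : MapsTo γ K O) :
    ∃ C, ∃ r > 0, ∀ ε ∈ Metric.ball (0 : ℝ) r, ∀ s ∈ K,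
      γ s + ε • δ s ∈ O ∧ ‖fderiv ℝ Φ (γ s + ε • δ s) (δ s)‖ ≤ C := by
  obtain ⟨ρ, -, hsub, r, hr, hvar⟩ := exists_cthickening_curve_subset hO hK hγ hδ hmem
  obtain ⟨C, hC⟩ := (hK.image_of_continuousOn hγ).cthickening (r := ρ)
    |>.exists_bound_of_continuousOn (hΦ.mono hsub)
  obtain ⟨M, hM⟩ := hK.exists_bound_of_continuousOn hδ
  refine ⟨C * M, r, hr, fun ε hε s hs => ⟨hsub (hvar ε hε s hs), ?_⟩⟩
  have hCs := hC _ (hvar ε hε s hs)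
  exact (ContinuousLinearMap.le_opNorm _ _).trans
    (mul_le_mul hCs (hM s hs) (norm_nonneg _) ((norm_nonneg _).trans hCs))

theorem aestronglyMeasurable_fderiv_variation (hΦ : ContinuousOn (fderiv ℝ Φ) O)
    (hK : IsCompact K) (hγ : ContinuousOn γ K) (hδ : ContinuousOn δ K) (hγO : MapsTo γ K O)
    (hδK : ∀ s ∈ Icc a b \ K, δ s = 0) (hab : a ≤ b) :
    MeasureTheory.AEStronglyMeasurable (fun s => fderiv ℝ Φ (γ s) (δ s))
      (MeasureTheory.volume.restrict (uIoc a b)) := by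
  have hind : (fun s => fderiv ℝ Φ (γ s) (δ s)) =ᵐ[MeasureTheory.volume.restrict (uIoc a b)]
      K.indicator fun s => fderiv ℝ Φ (γ s) (δ s) := by
    filter_upwards [MeasureTheory.ae_restrict_mem measurableSet_uIoc] with s hs
    rw [uIoc_of_le hab] at hs
    by_cases hsK : s ∈ K
    · rw [indicator_of_mem hsK]
    · rw [indicator_of_notMem hsK, hδK s ⟨Ioc_subset_Icc_self hs, hsK⟩, map_zero]
  refine (MeasureTheory.AEStronglyMeasurable.congr ?_ hind.symm)
  exact ((aestronglyMeasurable_indicator_iff hK.measurableSet).2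
    (((hΦ.comp hγ hγO).clm_apply hδ).aestronglyMeasurable hK.measurableSet)).restrict

-- `Φ` will be `F²`, which need not be smooth at zero velocity: hence the assumption on the support
-- of `δ`.
theorem hasDerivAt_integral_variation [ProperSpace E] (hO : IsOpen O) (hOW : O ⊆ W)
    (hΦ : ContDiffOn ℝ 1 Φ O) (hΦW : ContinuousOn Φ W) (hK : IsCompact K) (hKab : K ⊆ Icc a b)
    (hγ : ContinuousOn γ (Icc a b)) (hδ : ContinuousOn δ (Icc a b)) (hγW : MapsTo γ (Icc a b) W)
    (hγO : MapsTo γ K O) (hδK : ∀ s ∈ Icc a b \ K, δ s = 0) (hab : a ≤ b) :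
    HasDerivAt (fun ε : ℝ => ∫ s in a..b, Φ (γ s + ε • δ s))
      (∫ s in a..b, fderiv ℝ Φ (γ s) (δ s)) 0 := by
  have hΦ' : ContinuousOn (fderiv ℝ Φ) O := hΦ.continuousOn_fderiv_of_isOpen hO le_rfl
  have hγK := hγ.mono hKab
  have hδK' := hδ.mono hKab
  obtain ⟨C, r, hr, hvar⟩ := exists_norm_fderiv_variation_le hO hΦ' hK hγK hδK' hγO
  have hball := Metric.ball_mem_nhds (0 : ℝ) hr
  have hI : uIoc a b ⊆ Icc a b := by simpa only [uIoc_of_le hab] using Ioc_subset_Icc_self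
  have hcont : ∀ ε ∈ Metric.ball (0 : ℝ) r,
      ContinuousOn (fun s => Φ (γ s + ε • δ s)) (Icc a b) := fun ε hε =>
    hΦW.comp (hγ.add (hδ.const_smul ε)) fun s hs => by
      by_cases hsK : s ∈ K
      · exact hOW (hvar ε hε s hsK).1
      · simpa [hδK s ⟨hs, hsK⟩] using hγW hs
  have hderiv := intervalIntegral.hasDerivAt_integral_of_dominated_loc_of_deriv_le
    (μ := MeasureTheory.volume) (a := a) (b := b) (F := fun ε s => Φ (γ s + ε • δ s))
    (F' := fun ε s => fderiv ℝ Φ (γ s + ε • δ s) (δ s)) (bound := fun _ => max C 0) hball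
    (eventually_of_mem hball fun ε hε =>
      ((hcont ε hε).mono hI).aestronglyMeasurable measurableSet_uIoc)
    ((hcont 0 (Metric.mem_ball_self hr)).mono (by rw [uIcc_of_le hab])).intervalIntegrable
    (by simpa only [zero_smul, add_zero] using
      aestronglyMeasurable_fderiv_variation hΦ' hK hγK hδK' hγO hδK hab)
    (Eventually.of_forall fun s hs ε hε => ?_) intervalIntegrable_const
    (Eventually.of_forall fun s hs ε hε => ?_)
  · simpa using hderiv.2
  · by_cases hsK : s ∈ K
    · exact (hvar ε hε s hsK).2.trans (le_max_left _ _)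
    · simp [hδK s ⟨hI hs, hsK⟩]
  · by_cases hsK : s ∈ K
    · exact (((hΦ.contDiffAt (hO.mem_nhds (hvar ε hε s hsK).1)).differentiableAt
        one_ne_zero).hasFDerivAt).comp_hasDerivAt ε (by
          simpa using ((hasDerivAt_id ε).smul_const (δ s)).const_add (γ s))
    · simpa [hδK s ⟨hI hs, hsK⟩] using hasDerivAt_const ε (Φ (γ s))

end

/-! ### The lemma of du Bois-Reymond -/

section

variable {a b c d : ℝ} {q u v k : ℝ → ℝ}

theorem deriv_eq_zero_of_eq_zero_off_Ioo {E : Type*} [NormedAddCommGroup E] [NormedSpace ℝ E]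
    {f : ℝ → E} (hf : Differentiable ℝ f) (hzero : ∀ s ∉ Ioo c d, f s = 0) {s : ℝ}
    (hs : s ∉ Ioo c d) : deriv f s = 0 := by
  have huniq {t : Set ℝ} (ht : UniqueDiffWithinAt ℝ t s) (hsub : t ⊆ (Ioo c d)ᶜ) :
      deriv f s = 0 := by
    rw [← (hf s).derivWithin ht, derivWithin_congr (fun r hr => hzero r (hsub hr)) (hzero s hs),
      derivWithin_fun_const, Pi.zero_apply]
  rcases le_or_gt s c with hsc | hsc
  · exact huniq (uniqueDiffOn_Iic c s hsc) fun r hr hr' => hr'.1.not_ge hr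
  · have hds : d ≤ s := not_lt.1 fun hsd => hs ⟨hsc, hsd⟩
    exact huniq (uniqueDiffOn_Ici d s hds) fun r hr hr' => hr'.2.not_ge hr

theorem integral_eq_zero_off_Ioo (hk : Continuous k) (hzero : ∀ s ∉ Ioo c d, k s = 0)
    (hint : ∫ s in c..d, k s = 0) {s : ℝ} (hs : s ∉ Ioo c d) : ∫ t in c..s, k t = 0 := by
  have hvanish {r r' : ℝ} (h : ∀ t ∈ uIcc r r', t ∉ Ioo c d) : ∫ t in r..r', k t = 0 := by
    rw [intervalIntegral.integral_congr (g := fun _ => 0) fun t ht => hzero t (h t ht),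
      intervalIntegral.integral_zero]
  rcases le_or_gt s c with hsc | hsc
  · refine hvanish fun t ht ht' => ht'.1.not_ge ?_
    rw [uIcc_of_ge hsc] at ht
    exact ht.2
  · have hds : d ≤ s := not_lt.1 fun hsd => hs ⟨hsc, hsd⟩
    rw [← intervalIntegral.integral_add_adjacent_intervals (hk.intervalIntegrable c d)
      (hk.intervalIntegrable d s), hint, zero_add]
    refine hvanish fun t ht ht' => ht'.2.not_ge ?_
    rw [uIcc_of_le hds] at ht
    exact ht.1

/-- A weight supported on `[c, d]`, used to localize test functions. -/
noncomputable def intervalWeight (c d s : ℝ) : ℝ := max 0 ((s - c) * (d - s))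

theorem continuous_intervalWeight (c d : ℝ) : Continuous (intervalWeight c d) := by
  unfold intervalWeight
  fun_prop

theorem intervalWeight_nonneg (c d s : ℝ) : 0 ≤ intervalWeight c d s := le_max_left _ _

theorem intervalWeight_pos {s : ℝ} (hs : s ∈ Ioo c d) : 0 < intervalWeight c d s :=
  lt_max_of_lt_right (mul_pos (sub_pos.2 hs.1) (sub_pos.2 hs.2))

theorem intervalWeight_eq_zero (hcd : c < d) {s : ℝ} (hs : s ∉ Ioo c d) :
    intervalWeight c d s = 0 := by
  refine max_eq_left ?_
  rcases le_or_gt s c with hsc | hsc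
  · exact mul_nonpos_of_nonpos_of_nonneg (by linarith) (by linarith)
  · have hds : d ≤ s := not_lt.1 fun hsd => hs ⟨hsc, hsd⟩
    exact mul_nonpos_of_nonneg_of_nonpos (by linarith) (by linarith)

theorem integral_intervalWeight_mul_pos (hcd : c < d) {f : ℝ → ℝ} (hf : Continuous f)
    (hnonneg : ∀ s, 0 ≤ f s) {s : ℝ} (hs : s ∈ Ioo c d) (hpos : 0 < f s) :
    0 < ∫ t in c..d, intervalWeight c d t * f t :=
  intervalIntegral.integral_pos hcd ((continuous_intervalWeight c d).mul hf).continuousOn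
    (fun t _ => mul_nonneg (intervalWeight_nonneg c d t) (hnonneg t))
    ⟨s, Ioo_subset_Icc_self hs, mul_pos (intervalWeight_pos hs) hpos⟩

theorem exists_eq_const_of_integral_mul_eq_zero (hcd : c < d) (hq : Continuous q)
    (hortho : ∀ k : ℝ → ℝ, Continuous k → (∀ s ∉ Ioo c d, k s = 0) → ∫ s in c..d, k s = 0 →
      ∫ s in c..d, k s * q s = 0) : ∃ C, ∀ s ∈ Ioo c d, q s = C := by
  have hw := continuous_intervalWeight c d
  have hI : 0 < ∫ t in c..d, intervalWeight c d t := by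
    simpa using integral_intervalWeight_mul_pos hcd continuous_const (fun _ => zero_le_one)
      (s := (c + d) / 2) ⟨by linarith, by linarith⟩ one_pos
  let C := (∫ s in c..d, intervalWeight c d s * q s) / ∫ s in c..d, intervalWeight c d s
  have hmean : ∫ s in c..d, intervalWeight c d s * (q s - C) = 0 := by
    simp only [mul_sub]
    rw [intervalIntegral.integral_sub, intervalIntegral.integral_mul_const,
      mul_div_cancel₀ _ hI.ne', sub_self]
    all_goals exact Continuous.intervalIntegrable (by fun_prop) _ _
  have hC : Continuous fun s => q s - C := hq.sub continuous_const
  have hvar : ∫ s in c..d, intervalWeight c d s * (q s - C) ^ 2 = 0 := by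
    have hmul := hortho (fun s => intervalWeight c d s * (q s - C)) (hw.mul hC)
      (fun s hs => by rw [intervalWeight_eq_zero hcd hs, zero_mul]) hmean
    calc ∫ s in c..d, intervalWeight c d s * (q s - C) ^ 2
        = ∫ s in c..d, (intervalWeight c d s * (q s - C) * q s
            - C * (intervalWeight c d s * (q s - C))) := by congr with s; ring
      _ = 0 := by
        rw [intervalIntegral.integral_sub, hmul, intervalIntegral.integral_const_mul, hmean,
          mul_zero, sub_zero]
        all_goals exact Continuous.intervalIntegrable (by fun_prop) _ _
  refine ⟨C, fun s hs => by_contra fun hne => hvar.not_gt ?_⟩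
  exact integral_intervalWeight_mul_pos hcd (hC.pow 2) (fun _ => sq_nonneg _) hs
    (sq_pos_of_ne_zero (sub_ne_zero.2 hne))

theorem hasDerivAt_of_integral_variation_eq_zero_of_continuous (hcd : c < d)
    (hu : Continuous u) (hv : Continuous v)
    (hvar : ∀ φ : ℝ → ℝ, ContDiff ℝ 1 φ → (∀ s ∉ Ioo c d, φ s = 0) →
      ∫ s in c..d, (φ s * u s + deriv φ s * v s) = 0)
    {s : ℝ} (hs : s ∈ Ioo c d) : HasDerivAt v (u s) s := by
  let V : ℝ → ℝ := fun s => ∫ t in c..s, u t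
  have hV (s : ℝ) : HasDerivAt V (u s) s := (hu.integral_hasStrictDerivAt c s).hasDerivAt
  have hVc : Continuous V := continuous_iff_continuousAt.2 fun s => (hV s).continuousAt
  obtain ⟨C, hC⟩ := exists_eq_const_of_integral_mul_eq_zero hcd (hv.sub hVc)
    fun k hk hzero hint => by
      let φ : ℝ → ℝ := fun s => ∫ t in c..s, k t
      have hφ (s : ℝ) : HasDerivAt φ (k s) s := (hk.integral_hasStrictDerivAt c s).hasDerivAt
      have hderiv : deriv φ = k := funext fun s => (hφ s).deriv
      have hφ1 : ContDiff ℝ 1 φ :=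
        contDiff_one_iff_deriv.2 ⟨fun s => (hφ s).differentiableAt, by rwa [hderiv]⟩
      have hφ0 : ∀ s ∉ Ioo c d, φ s = 0 := fun s hs => integral_eq_zero_off_Ioo hk hzero hint hs
      have hparts : ∫ s in c..d, (k s * V s + φ s * u s) = 0 := by
        rw [intervalIntegral.integral_eq_sub_of_hasDerivAt (fun s _ => (hφ s).mul (hV s))
          (((hk.mul hVc).add (hφ1.continuous.mul hu)).intervalIntegrable _ _), Pi.mul_apply,
          Pi.mul_apply, hφ0 c (by simp), hφ0 d (by simp), zero_mul, zero_mul, sub_zero]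
      have hφvar := hvar φ hφ1 hφ0
      rw [hderiv] at hφvar
      calc ∫ s in c..d, k s * (v s - V s)
          = ∫ s in c..d, (φ s * u s + k s * v s - (k s * V s + φ s * u s)) := by
            congr with s; ring
        _ = 0 := by
          have hφc := hφ1.continuous
          rw [intervalIntegral.integral_sub, hφvar, hparts, sub_zero]
          all_goals exact Continuous.intervalIntegrable (by fun_prop) _ _
  have hveq : v =ᶠ[𝓝 s] fun s => V s + C := by
    filter_upwards [Ioo_mem_nhds hs.1 hs.2] with t ht
    rw [← hC t ht, Pi.sub_apply, add_sub_cancel]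
  exact ((hV s).add_const C).congr_of_eventuallyEq hveq

theorem hasDerivAt_of_integral_variation_eq_zero (hcd : c < d)
    (hu : ContinuousOn u (Icc c d)) (hv : ContinuousOn v (Icc c d))
    (hvar : ∀ φ : ℝ → ℝ, ContDiff ℝ 1 φ → (∀ s ∉ Ioo c d, φ s = 0) →
      ∫ s in c..d, (φ s * u s + deriv φ s * v s) = 0)
    {s : ℝ} (hs : s ∈ Ioo c d) : HasDerivAt v (u s) s := by
  have hext (f : ℝ → ℝ) : EqOn (IccExtend hcd.le ((Icc c d).domRestrict f)) f (Icc c d) :=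
    fun t ht => by rw [IccExtend_of_mem hcd.le _ ht, domRestrict_apply]
  rw [← hext u (Ioo_subset_Icc_self hs)]
  refine (hasDerivAt_of_integral_variation_eq_zero_of_continuous hcd
    (continuous_IccExtend_iff.2 hu.domRestrict) (continuous_IccExtend_iff.2 hv.domRestrict)
    (fun φ hφ hzero => (intervalIntegral.integral_congr fun t ht => ?_).trans (hvar φ hφ hzero))
    hs).congr_of_eventuallyEq ((hext v).symm.eventuallyEq_of_mem (Icc_mem_nhds hs.1 hs.2))
  rw [uIcc_of_le hcd.le] at ht
  simp only [hext _ ht]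

end

section

variable {n : ℕ} {U : Set (Space n)} {F P : Space n → Space n → ℝ} {x y : Space n} {a b : ℝ}

/-! ### Geodesics -/

theorem hasDerivWithinAt_derivWithin {E : Type*} [NormedAddCommGroup E] [NormedSpace ℝ E]
    {f : ℝ → E} {K : Set ℝ} (hf : ContDiffOn ℝ 1 f K) {s : ℝ} (hs : s ∈ K) :
    HasDerivWithinAt f (derivWithin f K s) K s :=
  (hf.differentiableOn one_ne_zero s hs).hasDerivWithinAt

theorem hasDerivAt_derivWithin_Icc {E : Type*} [NormedAddCommGroup E] [NormedSpace ℝ E]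
    {f : ℝ → E} (hf : ContDiffOn ℝ 1 f (Icc a b)) {s : ℝ} (hs : s ∈ Ioo a b) :
    HasDerivAt f (derivWithin f (Icc a b) s) s :=
  (hasDerivWithinAt_derivWithin hf (Ioo_subset_Icc_self hs)).hasDerivAt (Icc_mem_nhds hs.1 hs.2)

namespace IsStronglyConvex

variable (hF : IsStronglyConvex U F) (hU : IsOpen U)
include hF hU

theorem hasDerivAt_energy_variation {β η : ℝ → Space n} {K : Set ℝ} (hab : a < b)
    (hβ : ContDiffOn ℝ 1 β (Icc a b)) (hmem : ∀ s ∈ Icc a b, β s ∈ U)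
    (hη : ContDiffOn ℝ 1 η (Icc a b)) (hK : IsCompact K) (hKab : K ⊆ Icc a b)
    (hne : ∀ s ∈ K, derivWithin β (Icc a b) s ≠ 0)
    (hηK : ∀ s ∈ Icc a b \ K, η s = 0 ∧ derivWithin η (Icc a b) s = 0) :
    HasDerivAt (fun ε : ℝ => energy F a b fun s => β s + ε • η s)
      (∫ s in a..b, fderiv ℝ (fun p : Space n × Space n => lagrangian F p.1 p.2)
        (β s, derivWithin β (Icc a b) s) (η s, derivWithin η (Icc a b) s)) 0 := by
  have hud := uniqueDiffOn_Icc hab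
  have hvar := hasDerivAt_integral_variation (W := U ×ˢ univ) (isOpen_slit hU)
    (prod_mono_right (subset_univ _)) (ContDiffOn.of_le hF.isSmoothOffZero_lagrangian (by simp))
    (hF.continuousOn.pow 2) hK hKab
    (hβ.continuousOn.prodMk (hβ.continuousOn_derivWithin hud le_rfl))
    (hη.continuousOn.prodMk (hη.continuousOn_derivWithin hud le_rfl))
    (fun s hs => ⟨hmem s hs, mem_univ _⟩) (fun s hs => ⟨hmem s (hKab hs), hne s hs⟩)
    (fun s hs => Prod.ext (hηK s hs).1 (hηK s hs).2) hab.le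
  refine hvar.congr_of_eventuallyEq (Eventually.of_forall fun ε =>
    intervalIntegral.integral_congr fun s hs => ?_)
  rw [uIcc_of_le hab.le] at hs
  have hderiv : derivWithin (fun s => β s + ε • η s) (Icc a b) s =
      derivWithin β (Icc a b) s + ε • derivWithin η (Icc a b) s :=
    ((hasDerivWithinAt_derivWithin hβ hs).add
      ((hasDerivWithinAt_derivWithin hη hs).const_smul ε)).derivWithin (hud s hs)
  simp only [hderiv, Prod.smul_mk, Prod.mk_add_mk, lagrangian]

theorem integral_fderiv_lagrangian_eq_zero {β γ η η' : ℝ → Space n} (hab : a < b)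
    (hβ : ContinuousOn β (Icc a b)) (hγ : ContinuousOn γ (Icc a b))
    (hmem : ∀ s ∈ Icc a b, β s ∈ U) (hne : ∀ s ∈ Icc a b, γ s ≠ 0)
    (hEL : ∀ s ∈ Ioo a b, ∀ m, HasDerivAt (fun s => partialY m (lagrangian F) (β s) (γ s))
      (partialX m (lagrangian F) (β s) (γ s)) s)
    (hη : ContinuousOn η (Icc a b)) (hη' : ContinuousOn η' (Icc a b))
    (hderiv : ∀ s ∈ Ioo a b, HasDerivAt η (η' s) s) (ha : η a = 0) (hb : η b = 0) :
    ∫ s in a..b, fderiv ℝ (fun p : Space n × Space n => lagrangian F p.1 p.2)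
      (β s, γ s) (η s, η' s) = 0 := by
  have hL := hF.isSmoothOffZero_lagrangian
  have hβγ := hβ.prodMk hγ
  have hslit : MapsTo (fun s => (β s, γ s)) (Icc a b) (U ×ˢ ({0}ᶜ : Set (Space n))) :=
    fun s hs => ⟨hmem s hs, hne s hs⟩
  have hfderiv : ContinuousOn (fderiv ℝ fun p : Space n × Space n => lagrangian F p.1 p.2)
      (U ×ˢ {0}ᶜ) :=
    ContDiffOn.continuousOn_fderiv_of_isOpen hL (isOpen_slit hU) (by simp)
  rw [intervalIntegral.integral_eq_sub_of_hasDerivAt_of_le hab.le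
    (f := fun s => ∑ m, η s m * partialY m (lagrangian F) (β s) (γ s)), ha, hb]
  · simp
  · exact continuousOn_finsetSum _ fun m _ =>
      ((EuclideanSpace.proj (𝕜 := ℝ) m).continuous.comp_continuousOn hη).mul
        ((ContDiffOn.continuousOn (hL.partialY hU m)).comp hβγ hslit)
  · intro s hs
    have hcoord (m : Fin n) : HasDerivAt (fun s => η s m) (η' s m) s :=
      (EuclideanSpace.proj (𝕜 := ℝ) m).hasFDerivAt.comp_hasDerivAt s (hderiv s hs)
    refine (HasDerivAt.fun_sum fun m _ => (hcoord m).mul (hEL s hs m)).congr_deriv ?_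
    have hs' := Ioo_subset_Icc_self hs
    rw [hL.fderiv_apply hU (hmem s hs') (hne s hs'), ← Finset.sum_add_distrib]
    exact Finset.sum_congr rfl fun m _ => add_comm _ _
  · refine ContinuousOn.intervalIntegrable ?_
    rw [uIcc_of_le hab.le]
    exact (hfderiv.comp hβγ hslit).clm_apply (hη.prodMk hη')

theorem hasDerivAt_partialY_lagrangian {β γ : ℝ → Space n} {c s : ℝ}
    (hβ : HasDerivAt β (γ s) s) (hγ : HasDerivAt γ (c • γ s) s) (hx : β s ∈ U) (hy : γ s ≠ 0)
    (m : Fin n) :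
    HasDerivAt (fun s => partialY m (lagrangian F) (β s) (γ s))
      (flatSpray (partialY m (lagrangian F)) (β s) (γ s) +
        c * partialY m (lagrangian F) (β s) (γ s)) s := by
  have hLm := hF.isSmoothOffZero_lagrangian.partialY hU m
  refine (hLm.hasDerivAt_comp hU hβ hγ hx hy).congr_deriv ?_
  have heuler := (hF.isHomogeneous_lagrangian.partialY hF.isSmoothOffZero_lagrangian hU m).euler
    hLm hU hx hy
  simp only [PiLp.smul_apply, smul_eq_mul, mul_assoc, ← Finset.mul_sum, heuler]
  simp [flatSpray]

theorem isGeodesic_of_hasDerivAt (hP : IsProjectiveFactor U F P) (hab : a < b)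
    {β γ : ℝ → Space n} (hβ : ∀ s ∈ Icc a b, HasDerivAt β (γ s) s)
    (hγ : ContinuousOn γ (Icc a b))
    (hγ' : ∀ s ∈ Ioo a b, HasDerivAt γ (-(2 * P (β s) (γ s)) • γ s) s)
    (hmem : ∀ s ∈ Icc a b, β s ∈ U) (hne : ∀ s ∈ Icc a b, γ s ≠ 0) :
    IsGeodesic U F a b β := by
  have hud := uniqueDiffOn_Icc hab
  have hderiv : EqOn (derivWithin β (Icc a b)) γ (Icc a b) := fun s hs =>
    (hβ s hs).hasDerivWithinAt.derivWithin (hud s hs)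
  have hβ1 : ContDiffOn ℝ 1 β (Icc a b) := (contDiffOn_one_iff_derivWithin hud).2
    ⟨fun s hs => (hβ s hs).differentiableAt.differentiableWithinAt, hγ.congr hderiv⟩
  have hEL : ∀ s ∈ Ioo a b, ∀ m, HasDerivAt (fun s => partialY m (lagrangian F) (β s) (γ s))
      (partialX m (lagrangian F) (β s) (γ s)) s := fun s hs m => by
    have hs' := Ioo_subset_Icc_self hs
    refine (hF.hasDerivAt_partialY_lagrangian hU (hβ s hs') (hγ' s hs) (hmem s hs') (hne s hs')
      m).congr_deriv ?_
    have hm := hP _ (hmem s hs') _ (hne s hs') m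
    rw [flatEulerLagrange] at hm
    linarith
  refine ⟨hβ1, hmem, fun η hη ha hb => ?_⟩
  refine (hF.hasDerivAt_energy_variation hU hab hβ1 hmem hη isCompact_Icc subset_rfl
    (fun s hs => by rw [hderiv hs]; exact hne s hs) fun s hs => absurd hs.1 hs.2).congr_deriv ?_
  rw [intervalIntegral.integral_congr (g := fun s =>
    fderiv ℝ (fun p : Space n × Space n => lagrangian F p.1 p.2) (β s, γ s)
      (η s, derivWithin η (Icc a b) s)) fun s hs => by
    rw [uIcc_of_le hab.le] at hs
    simp only [hderiv hs]]
  exact hF.integral_fderiv_lagrangian_eq_zero hU hab hβ1.continuousOn hγ hmem hne hEL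
    hη.continuousOn (hη.continuousOn_derivWithin hud le_rfl)
    (fun s hs => hasDerivAt_derivWithin_Icc hη hs) ha hb

theorem integral_variation_eq_zero_of_isGeodesic {β : ℝ → Space n} (hab : a < b)
    (hg : IsGeodesic U F a b β) {c d : ℝ} (hcd : c < d) (hsub : Icc c d ⊆ Ioo a b)
    (hne : ∀ s ∈ Icc c d, derivWithin β (Icc a b) s ≠ 0) {φ : ℝ → ℝ} (hφ : ContDiff ℝ 1 φ)
    (hzero : ∀ s ∉ Ioo c d, φ s = 0) (m : Fin n) :
    ∫ s in c..d, (φ s * partialX m (lagrangian F) (β s) (derivWithin β (Icc a b) s) +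
      deriv φ s * partialY m (lagrangian F) (β s) (derivWithin β (Icc a b) s)) = 0 := by
  have hud := uniqueDiffOn_Icc hab
  have hsub' := hsub.trans Ioo_subset_Icc_self
  let η : ℝ → Space n := fun s => φ s • basisVec m
  have hη : ContDiffOn ℝ 1 η (Icc a b) := (hφ.smul contDiff_const).contDiffOn
  have hη' : ∀ s ∈ Icc a b, derivWithin η (Icc a b) s = deriv φ s • basisVec m := fun s hs =>
    ((hφ.differentiable one_ne_zero s).hasDerivAt.smul_const _).hasDerivWithinAt.derivWithin
      (hud s hs)
  have hzero' : ∀ s ∉ Ioo c d, deriv φ s = 0 := fun s hs =>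
    deriv_eq_zero_of_eq_zero_off_Ioo (hφ.differentiable one_ne_zero) hzero hs
  have hoff {s : ℝ} (hs : s ∈ Icc a b) (hs' : s ∉ Ioo c d) :
      η s = 0 ∧ derivWithin η (Icc a b) s = 0 := by
    rw [hη' s hs, hzero' s hs', zero_smul]
    exact ⟨by simp only [η, hzero s hs', zero_smul], rfl⟩
  have hca := (hsub (left_mem_Icc.2 hcd.le)).1
  have hdb := (hsub (right_mem_Icc.2 hcd.le)).2
  have hcrit := (hF.hasDerivAt_energy_variation hU hab hg.contDiffOn hg.mem hη isCompact_Icc hsub'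
    hne fun s hs => hoff hs.1 fun h => hs.2 (Ioo_subset_Icc_self h)).unique
    (hg.critical η hη (hoff (left_mem_Icc.2 hab.le) fun h => h.1.not_gt hca).1
      (hoff (right_mem_Icc.2 hab.le) fun h => h.2.not_gt hdb).1)
  rw [intervalIntegral.integral_of_le hab.le,
    MeasureTheory.setIntegral_eq_of_subset_of_forall_sdiff_eq_zero measurableSet_Ioc
      (Ioc_subset_Ioc hca.le hdb.le) fun s hs => by
        obtain ⟨hη0, hη'0⟩ := hoff (Ioc_subset_Icc_self hs.1) fun h => hs.2 (Ioo_subset_Ioc_self h)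
        rw [hη0, hη'0, Prod.mk_zero_zero, map_zero], ← intervalIntegral.integral_of_le hcd.le]
    at hcrit
  rw [← hcrit]
  refine intervalIntegral.integral_congr fun s hs => ?_
  rw [uIcc_of_le hcd.le] at hs
  simp only [hF.isSmoothOffZero_lagrangian.fderiv_apply hU (hg.mem s (hsub' hs)) (hne s hs),
    hη' s (hsub' hs), η, PiLp.smul_apply, smul_eq_mul, mul_assoc, ← Finset.mul_sum,
    sum_basisVec_mul]

theorem hasDerivAt_partialY_lagrangian_of_isGeodesic {β : ℝ → Space n} (hab : a < b)
    (hg : IsGeodesic U F a b β) {s : ℝ} (hs : s ∈ Ioo a b)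
    (hne : derivWithin β (Icc a b) s ≠ 0) (m : Fin n) :
    HasDerivAt (fun s => partialY m (lagrangian F) (β s) (derivWithin β (Icc a b) s))
      (partialX m (lagrangian F) (β s) (derivWithin β (Icc a b) s)) s := by
  have hL := hF.isSmoothOffZero_lagrangian
  have hβ' := hg.contDiffOn.continuousOn_derivWithin (uniqueDiffOn_Icc hab) le_rfl
  obtain ⟨r, hr, hnear⟩ := (nhds_basis_Icc_pos s).eventually_iff.1
    (((hβ'.continuousAt (Icc_mem_nhds hs.1 hs.2)).eventually_ne hne).and (Ioo_mem_nhds hs.1 hs.2))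
  have hsub : Icc (s - r) (s + r) ⊆ Ioo a b := fun t ht => (hnear ht).2
  have hsub' := hsub.trans Ioo_subset_Icc_self
  have hcurve := (hg.contDiffOn.continuousOn.mono hsub').prodMk (hβ'.mono hsub')
  have hslit : MapsTo (fun s => (β s, derivWithin β (Icc a b) s)) (Icc (s - r) (s + r))
      (U ×ˢ ({0}ᶜ : Set (Space n))) := fun t ht => ⟨hg.mem t (hsub' ht), (hnear ht).1⟩
  have hcd : s - r < s + r := by linarith
  exact hasDerivAt_of_integral_variation_eq_zero hcd
    ((ContDiffOn.continuousOn (hL.partialX hU m)).comp hcurve hslit)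
    ((ContDiffOn.continuousOn (hL.partialY hU m)).comp hcurve hslit)
    (fun φ hφ hzero => hF.integral_variation_eq_zero_of_isGeodesic hU hab hg hcd hsub
      (fun t ht => (hnear ht).1) hφ hzero m) ⟨by linarith, by linarith⟩

end IsStronglyConvex

/-! ### Projectively flat metrics -/

theorem exists_line_coordinate {β : ℝ → Space n} {p e : Space n} {τ : ℝ} (he : e ≠ 0)
    (hβ : ContDiffOn ℝ 1 β (Icc a b)) (hseg : ∀ s ∈ Icc a b, β s ∈ segment ℝ p (p + τ • e)) :
    ∃ θ : ℝ → ℝ, ContDiffOn ℝ 1 θ (Icc a b) ∧ ∀ s ∈ Icc a b, β s = p + θ s • e := by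
  have hee : inner ℝ e e ≠ 0 := inner_self_ne_zero.2 he
  refine ⟨fun s => inner ℝ e (β s - p) / inner ℝ e e,
    (contDiffOn_const.inner ℝ (hβ.sub contDiffOn_const)).div_const _, fun s hs => ?_⟩
  obtain ⟨t, -, ht⟩ := (segment_eq_image' ℝ p (p + τ • e)) ▸ hseg s hs
  simp only [add_sub_cancel_left, smul_smul] at ht
  simp only [← ht, add_sub_cancel_left, inner_smul_right, mul_div_cancel_right₀ _ hee]

theorem exists_derivWithin_pos {θ : ℝ → ℝ} (hab : a < b) (hθ : ContDiffOn ℝ 1 θ (Icc a b))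
    (hlt : θ a < θ b) : ∃ s ∈ Ioo a b, 0 < derivWithin θ (Icc a b) s := by
  obtain ⟨s, hs, hslope⟩ := exists_hasDerivAt_eq_slope θ (derivWithin θ (Icc a b)) hab
    hθ.continuousOn fun s hs => hasDerivAt_derivWithin_Icc hθ hs
  exact ⟨s, hs, hslope ▸ div_pos (sub_pos.2 hlt) (sub_pos.2 hab)⟩

namespace IsStronglyConvex

variable (hF : IsStronglyConvex U F) (hU : IsOpen U)
include hF hU

theorem partialY_lagrangian_smul {c : ℝ} (hx : x ∈ U) (hy : y ≠ 0) (hc : 0 < c) (m : Fin n) :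
    partialY m (lagrangian F) x (c • y) = c * partialY m (lagrangian F) x y := by
  simpa using hF.isHomogeneous_lagrangian.partialY hF.isSmoothOffZero_lagrangian hU m x hx y hy c hc

theorem isHomogeneous_flatEulerLagrange (m : Fin n) :
    IsHomogeneousOfDegree U 2 (flatEulerLagrange F m) := by
  intro x hx y hy c hc
  have hL := hF.isSmoothOffZero_lagrangian
  have hL2 := hF.isHomogeneous_lagrangian
  rw [flatEulerLagrange, flatEulerLagrange, mul_sub,
    (hL2.partialY hL hU m).flatSpray (hL.partialY hU m) hU x hx y hy c hc,
    hL2.partialX hL hU m x hx y hy c hc]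

theorem differentiableAt_speed {β : ℝ → Space n} {σ : ℝ → ℝ} {v : Space n} {s : ℝ}
    (hβ : HasDerivAt β v s) (hσ : ContinuousAt σ s) (hpos : 0 < σ s) (hx : β s ∈ U) (hy : y ≠ 0)
    (hEL : ∀ m, DifferentiableAt ℝ (fun s => partialY m (lagrangian F) (β s) (σ s • y)) s) :
    DifferentiableAt ℝ σ s := by
  have hden : DifferentiableAt ℝ (fun t => 2 * lagrangian F (β t) y) s :=
    ((hF.isSmoothOffZero_lagrangian.hasDerivAt_comp hU hβ (hasDerivAt_const s y) hx
      hy).const_mul 2).differentiableAt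
  have hL0 {t : ℝ} (ht : β t ∈ U) : 2 * lagrangian F (β t) y ≠ 0 :=
    mul_ne_zero two_ne_zero (pow_pos (hF.pos _ ht y hy) 2).ne'
  have hnum : DifferentiableAt ℝ
      (fun t => ∑ m, y m * partialY m (lagrangian F) (β t) (σ t • y)) s :=
    DifferentiableAt.fun_sum fun m _ => (hEL m).const_mul (y m)
  refine (hnum.div hden (hL0 hx)).congr_of_eventuallyEq ?_
  filter_upwards [hβ.continuousAt.eventually (hU.mem_nhds hx), hσ.eventually (lt_mem_nhds hpos)]
    with t ht hσt
  simp only [Pi.div_apply, hF.partialY_lagrangian_smul hU ht hy hσt, mul_left_comm (y _) (σ t),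
    ← Finset.mul_sum, hF.sum_mul_partialY_lagrangian hU ht hy, mul_div_cancel_right₀ _ (hL0 ht)]

theorem exists_flatEulerLagrange_eq_of_hasDerivAt {β : ℝ → Space n} {σ : ℝ → ℝ} {s : ℝ}
    (hβ : HasDerivAt β (σ s • y) s) (hσ : ContinuousAt σ s) (hpos : 0 < σ s) (hx : β s ∈ U)
    (hy : y ≠ 0)
    (hEL : ∀ m, HasDerivAt (fun s => partialY m (lagrangian F) (β s) (σ s • y))
      (partialX m (lagrangian F) (β s) (σ s • y)) s) :
    ∃ μ, ∀ m, flatEulerLagrange F m (β s) y = μ * partialY m (lagrangian F) (β s) y := by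
  have hσ' := (hF.differentiableAt_speed hU hβ hσ hpos hx hy
    fun m => (hEL m).differentiableAt).hasDerivAt
  have hγ : HasDerivAt (fun t => σ t • y) ((deriv σ s / σ s) • σ s • y) s := by
    rw [smul_smul, div_mul_cancel₀ _ hpos.ne']
    exact hσ'.smul_const y
  refine ⟨-(deriv σ s / σ s ^ 2), fun m => ?_⟩
  have hm := (hF.hasDerivAt_partialY_lagrangian hU hβ hγ hx (smul_ne_zero hpos.ne' hy) m).unique
    (hEL m)
  have hscaled : flatEulerLagrange F m (β s) (σ s • y) =
      -(deriv σ s / σ s) * partialY m (lagrangian F) (β s) (σ s • y) := by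
    rw [flatEulerLagrange]
    linarith
  rw [hF.isHomogeneous_flatEulerLagrange hU m _ hx y hy _ hpos,
    hF.partialY_lagrangian_smul hU hx hy hpos] at hscaled
  field_simp at hscaled ⊢
  linarith

theorem exists_mem_segment_flatEulerLagrange_eq (hflat : IsProjectivelyFlat U F) {τ : ℝ}
    (hτ : 0 < τ) (hy : y ≠ 0) (hseg : segment ℝ x (x + τ • y) ⊆ U) :
    ∃ z ∈ segment ℝ x (x + τ • y), ∃ μ, ∀ m,
      flatEulerLagrange F m z y = μ * partialY m (lagrangian F) z y := by
  have hne : x ≠ x + τ • y := by simpa using And.intro hτ.ne' hy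
  obtain ⟨a, b, β, hab, hgeo, hbij, hβa, hβb⟩ := hflat x (x + τ • y) hne hseg
  obtain ⟨θ, hθ, hβθ⟩ := exists_line_coordinate hy hgeo.contDiffOn hbij.mapsTo
  have hθa : θ a = 0 := by simpa [hβa, hy] using hβθ a (left_mem_Icc.2 hab.le)
  have hθb : θ b = τ := by
    have h := hβθ b (right_mem_Icc.2 hab.le)
    rw [hβb, add_right_inj] at h
    exact (smul_left_injective ℝ hy h).symm
  obtain ⟨s, hs, hpos⟩ := exists_derivWithin_pos hab hθ (by rw [hθa, hθb]; exact hτ)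
  have hud := uniqueDiffOn_Icc hab
  have hβ' : ∀ t ∈ Icc a b, derivWithin β (Icc a b) t = derivWithin θ (Icc a b) t • y :=
    fun t ht => (((hasDerivWithinAt_derivWithin hθ ht).smul_const y).const_add x
      |>.congr hβθ (hβθ t ht)).derivWithin (hud t ht)
  have hs' := Ioo_subset_Icc_self hs
  refine ⟨β s, hbij.mapsTo hs', hF.exists_flatEulerLagrange_eq_of_hasDerivAt hU
    (hβ' s hs' ▸ hasDerivAt_derivWithin_Icc hgeo.contDiffOn hs)
    ((hθ.continuousOn_derivWithin hud le_rfl).continuousAt (Icc_mem_nhds hs.1 hs.2)) hpos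
    (hgeo.mem s hs') hy fun m => ?_⟩
  have hEL := hF.hasDerivAt_partialY_lagrangian_of_isGeodesic hU hab hgeo hs
    (hβ' s hs' ▸ smul_ne_zero hpos.ne' hy) m
  rw [hβ' s hs'] at hEL
  refine hEL.congr_of_eventuallyEq ?_
  filter_upwards [Icc_mem_nhds hs.1 hs.2] with t ht
  rw [hβ' t ht]

theorem two_mul_lagrangian_mul_flatEulerLagrange (hflat : IsProjectivelyFlat U F) (hx : x ∈ U)
    (hy : y ≠ 0) (m : Fin n) : 2 * lagrangian F x y * flatEulerLagrange F m x y =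
      flatSpray (lagrangian F) x y * partialY m (lagrangian F) x y := by
  have hL := hF.isSmoothOffZero_lagrangian
  have hcont {f : Space n → Space n → ℝ} (hf : IsSmoothOffZero U f) :
      ContinuousAt (fun z => f z y) x := (hf.differentiableAt_fst hU hx hy).continuousAt
  let f : Space n → ℝ := fun z => 2 * lagrangian F z y * flatEulerLagrange F m z y -
    flatSpray (lagrangian F) z y * partialY m (lagrangian F) z y
  have hf : ContinuousAt f x :=
    ((continuousAt_const.mul (hcont hL)).mul
      (hcont (hF.isSmoothOffZero_flatEulerLagrange hU m))).sub
      ((hcont (hL.flatSpray hU)).mul (hcont (hL.partialY hU m)))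
  by_contra hne
  obtain ⟨r, hr, hball⟩ := Metric.eventually_nhds_iff_ball.1
    ((hf.eventually_ne (sub_ne_zero.2 hne)).and (hU.mem_nhds hx))
  have hτ : 0 < r / (2 * ‖y‖) := by positivity
  have hend : x + (r / (2 * ‖y‖)) • y ∈ Metric.ball x r := by
    rw [Metric.mem_ball, dist_self_add_left, norm_smul, Real.norm_of_nonneg hτ.le]
    field_simp
    linarith
  have hseg := (convex_ball x r).segment_subset (Metric.mem_ball_self hr) hend
  obtain ⟨z, hz, μ, hμ⟩ := hF.exists_mem_segment_flatEulerLagrange_eq hU hflat hτ hy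
    fun z hz => (hball z (hseg hz)).2
  obtain ⟨hz0, hzU⟩ := hball z (hseg hz)
  refine hz0 ?_
  have hcontract := hF.sum_mul_flatEulerLagrange hU hzU hy
  simp only [hμ, mul_left_comm (y _) μ, ← Finset.mul_sum, hF.sum_mul_partialY_lagrangian hU hzU hy]
    at hcontract
  simp only [f, hμ, ← hcontract]
  ring

theorem exists_isProjectiveFactor (hflat : IsProjectivelyFlat U F) :
    ∃ P, IsProjectiveFactor U F P := by
  refine ⟨fun x y => flatSpray (lagrangian F) x y / (4 * lagrangian F x y),
    fun x hx y hy m => ?_⟩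
  have hL : 0 < lagrangian F x y := pow_pos (hF.pos x hx y hy) 2
  have h := hF.two_mul_lagrangian_mul_flatEulerLagrange hU hflat hx hy m
  field_simp
  linarith

end IsStronglyConvex

theorem exists_bijOn_hasDerivAt_inv {f : ℝ → ℝ} (hf : Continuous f) (hpos : ∀ t, 0 < f t)
    (hab : a < b) : ∃ (l : ℝ) (θ : ℝ → ℝ), 0 < l ∧ θ 0 = a ∧ θ l = b ∧
      BijOn θ (Icc 0 l) (Icc a b) ∧ ∀ s ∈ Icc 0 l, HasDerivAt θ (f (θ s))⁻¹ s := by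
  let S : ℝ → ℝ := fun t => ∫ v in a..t, f v
  have hderiv (t : ℝ) : HasStrictDerivAt S (f t) t := hf.integral_hasStrictDerivAt a t
  have hmono : StrictMono S := strictMono_of_hasDerivAt_pos (fun t => (hderiv t).hasDerivAt) hpos
  have hSa : S a = 0 := intervalIntegral.integral_same
  have himage : S '' Icc a b = Icc 0 (S b) := by
    have hcont : Continuous S := continuous_iff_continuousAt.2
      fun t => (hderiv t).hasDerivAt.continuousAt
    refine (image_subset_iff.2 fun t ht => ?_).antisymm
      (hSa ▸ intermediate_value_Icc hab.le hcont.continuousOn)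
    exact ⟨hSa ▸ hmono.monotone ht.1, hmono.monotone ht.2⟩
  have hinv := Function.leftInverse_invFun hmono.injective
  refine ⟨S b, Function.invFun S, hSa ▸ hmono hab, hSa ▸ hinv a, hinv b, ?_, ?_⟩
  · have hleft := hinv.leftInvOn (Icc a b)
    rw [← himage]
    exact (hmono.injective.injOn.bijOn_image).symm ⟨hleft.rightInvOn_image, hleft⟩
  · rw [← himage]
    rintro _ ⟨t, -, rfl⟩
    rw [hinv t]
    exact ((hderiv t).to_local_left_inverse (hpos t).ne' (Eventually.of_forall hinv)).hasDerivAt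

namespace IsProjectiveFactor

variable (hP : IsProjectiveFactor U F P) (hF : IsStronglyConvex U F) (hU : IsOpen U)
include hP hF hU

theorem hasDerivAt_inv {t : ℝ} (ht : x + t • y ∈ U) (hy : y ≠ 0) :
    HasDerivAt (fun t : ℝ => (F (x + t • y) y)⁻¹)
      (-(2 * P (x + t • y) y * (F (x + t • y) y)⁻¹)) t := by
  have hpos := hF.pos _ ht y hy
  refine ((hF.isSmoothOffZero.hasDerivAt_flatSpray hU ht hy).fun_inv hpos.ne').congr_deriv ?_
  rw [hP.flatSpray_eq hF hU ht hy]
  field_simp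

theorem isGeodesic_add_smul (hab : a < b) (hy : y ≠ 0) {θ : ℝ → ℝ}
    (hθ : ∀ s ∈ Icc a b, HasDerivAt θ (F (x + θ s • y) y)⁻¹ s)
    (hmem : ∀ s ∈ Icc a b, x + θ s • y ∈ U) : IsGeodesic U F a b fun s => x + θ s • y := by
  have hpos (s : ℝ) (hs : s ∈ Icc a b) : 0 < (F (x + θ s • y) y)⁻¹ :=
    inv_pos.2 (hF.pos _ (hmem s hs) y hy)
  have hinv (s : ℝ) (hs : s ∈ Icc a b) := (hP.hasDerivAt_inv hF hU (hmem s hs) hy).comp s (hθ s hs)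
  refine hF.isGeodesic_of_hasDerivAt hU hP hab (γ := fun s => (F (x + θ s • y) y)⁻¹ • y)
    (fun s hs => ((hθ s hs).smul_const y).const_add x)
    (fun s hs => ((hinv s hs).continuousAt.smul continuousAt_const).continuousWithinAt)
    (fun s hs => ?_) hmem fun s hs => smul_ne_zero (hpos s hs).ne' hy
  have hs' := Ioo_subset_Icc_self hs
  refine ((hinv s hs').smul_const y).congr_deriv ?_
  rw [hP.isHomogeneous hF hU _ (hmem s hs') y hy _ (hpos s hs')]
  module

theorem isProjectivelyFlat : IsProjectivelyFlat U F := by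
  intro p q hpq hseg
  have he : q - p ≠ 0 := sub_ne_zero.2 hpq.symm
  have hline : BijOn (fun t : ℝ => p + t • (q - p)) (Icc 0 1) (segment ℝ p q) := by
    rw [segment_eq_image']
    exact ((add_right_injective p).comp (smul_left_injective ℝ he)).injOn.bijOn_image
  let f : ℝ → ℝ := fun t => F (p + (projIcc (0 : ℝ) 1 zero_le_one t : ℝ) • (q - p)) (q - p)
  have hmem (t : ℝ) : p + (projIcc (0 : ℝ) 1 zero_le_one t : ℝ) • (q - p) ∈ U :=
    hseg (hline.mapsTo (projIcc _ _ _ t).2)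
  have hf : Continuous f := hF.continuousOn.comp_continuous
    (f := fun t => (p + (projIcc (0 : ℝ) 1 zero_le_one t : ℝ) • (q - p), q - p))
    (by fun_prop) fun t => ⟨hmem t, mem_univ _⟩
  have hpos (t : ℝ) : 0 < f t := hF.pos _ (hmem t) _ he
  obtain ⟨l, θ, hl, hθ0, hθl, hθbij, hθ⟩ := exists_bijOn_hasDerivAt_inv hf hpos zero_lt_one
  have hbij := hline.comp hθbij
  refine ⟨0, l, fun s => p + θ s • (q - p), hl, hP.isGeodesic_add_smul hF hU hl he ?_
    fun s hs => hseg (hbij.mapsTo hs), hbij, by simp [hθ0], by simp [hθl]⟩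
  intro s hs
  refine (hθ s hs).congr_deriv ?_
  simp only [f, projIcc_of_mem zero_le_one (hθbij.mapsTo hs)]

end IsProjectiveFactor

end

section

variable {n : ℕ} {U : Set (Space n)} {F : Space n → Space n → ℝ} {x p q : Space n}

/-! ### The distance and completeness -/

namespace IsFinslerMetric

variable (hF : IsFinslerMetric U F)
include hF

theorem apply_zero (hx : x ∈ U) : F x 0 = 0 := by
  simpa using hF.smul x hx 0 le_rfl 0

theorem nonneg (hx : x ∈ U) (ξ : Space n) : 0 ≤ F x ξ := by
  rcases eq_or_ne ξ 0 with rfl | h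
  · exact (hF.apply_zero hx).ge
  · exact (hF.pos x hx ξ h).le

theorem finslerDist_le {M : ℝ} (hseg : segment ℝ p q ⊆ U)
    (hM : ∀ x ∈ segment ℝ p q, F x (q - p) ≤ M) : finslerDist U F p q ≤ M := by
  let β : ℝ → Space n := fun s => p + s • (q - p)
  have hmem (s : ℝ) (hs : s ∈ Icc (0 : ℝ) 1) : β s ∈ segment ℝ p q := by
    rw [segment_eq_image']
    exact mem_image_of_mem _ hs
  have hderiv (s : ℝ) (hs : s ∈ Icc (0 : ℝ) 1) : derivWithin β (Icc 0 1) s = q - p := by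
    have h := ((hasDerivAt_id s).smul_const (q - p)).const_add p
    rw [one_smul] at h
    exact h.hasDerivWithinAt.derivWithin (uniqueDiffOn_Icc zero_lt_one s hs)
  have hlength : length F 0 1 β ≤ M := by
    have h : ‖length F 0 1 β‖ ≤ M * |1 - 0| := by
      refine intervalIntegral.norm_integral_le_of_norm_le_const fun s hs => ?_
      have hs' := Ioc_subset_Icc_self (uIoc_of_le (zero_le_one' ℝ) ▸ hs)
      rw [hderiv s hs', Real.norm_of_nonneg (hF.nonneg (hseg (hmem s hs')) _)]
      exact hM _ (hmem s hs')
    rw [sub_zero, abs_one, mul_one] at h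
    exact (le_abs_self _).trans h
  refine le_trans ?_ hlength
  refine csInf_le ⟨0, ?_⟩ ⟨β, ?_, fun s hs => hseg (hmem s hs), ?_, ?_, rfl⟩
  · rintro _ ⟨η, -, hη, -, -, rfl⟩
    exact intervalIntegral.integral_nonneg zero_le_one fun s hs => hF.nonneg (hη s hs) _
  · exact ContDiff.contDiffOn (by fun_prop)
  · simp only [β, zero_smul, add_zero]
  · simp only [β, one_smul, add_sub_cancel]

section

variable (hconv : Convex ℝ U) (hp : p ∈ U) (hq : q ∈ U) {C : ℝ} (hC : 0 < C)
include hconv hp hq hC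

theorem sub_le_mul_finslerDist {ψ : Space n → ℝ} {ψ' : Space n → Space n →L[ℝ] ℝ}
    (hψ : ∀ x ∈ U, HasFDerivAt ψ (ψ' x) x) (hle : ∀ x ∈ U, ∀ ξ, ψ' x ξ ≤ C * F x ξ) :
    ψ q - ψ p ≤ C * finslerDist U F p q := by
  rw [← div_le_iff₀' hC]
  refine le_csInf ⟨_, fun s => p + s • (q - p), ContDiff.contDiffOn (by fun_prop), fun s hs => ?_,
    by simp, by simp, rfl⟩ ?_
  · refine hconv.segment_subset hp hq ?_
    rw [segment_eq_image']
    exact mem_image_of_mem _ hs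
  rintro _ ⟨β, hβ, hmem, rfl, rfl, rfl⟩
  rw [div_le_iff₀' hC, length, ← intervalIntegral.integral_const_mul]
  have hcont : ContinuousOn (fun s => C * F (β s) (derivWithin β (Icc 0 1) s)) (Icc 0 1) :=
    continuousOn_const.mul (hF.continuousOn.comp (hβ.continuousOn.prodMk
      (hβ.continuousOn_derivWithin (uniqueDiffOn_Icc zero_lt_one) (by simp)))
      fun s hs => ⟨hmem s hs, mem_univ _⟩)
  refine intervalIntegral.sub_le_integral_of_hasDeriv_right_of_le zero_le_one
    (g := fun s => ψ (β s)) (g' := fun s => ψ' (β s) (derivWithin β (Icc 0 1) s))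
    (fun s hs => (hψ _ (hmem s hs)).continuousAt.comp_continuousWithinAt (hβ.continuousOn s hs))
    (fun s hs => ?_) hcont.integrableOn_Icc fun s hs => hle _ (hmem s (Ioo_subset_Icc_self hs)) _
  have hβ1 : ContDiffOn ℝ 1 β (Icc 0 1) := hβ.of_le (by simp)
  exact ((hψ _ (hmem s (Ioo_subset_Icc_self hs))).comp_hasDerivAt s
    (hasDerivAt_derivWithin_Icc hβ1 hs)).hasDerivWithinAt

theorem abs_sub_le_mul_finslerDist {ψ : Space n → ℝ} {ψ' : Space n → Space n →L[ℝ] ℝ}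
    (hψ : ∀ x ∈ U, HasFDerivAt ψ (ψ' x) x) (hle : ∀ x ∈ U, ∀ ξ, |ψ' x ξ| ≤ C * F x ξ) :
    |ψ q - ψ p| ≤ C * finslerDist U F p q := by
  have hupper := hF.sub_le_mul_finslerDist hconv hp hq hC hψ fun x hx ξ =>
    (le_abs_self _).trans (hle x hx ξ)
  have hlower := hF.sub_le_mul_finslerDist hconv hp hq hC (fun x hx => (hψ x hx).neg)
    fun x hx ξ => (neg_le_abs _).trans (hle x hx ξ)
  simp only [Pi.neg_apply] at hlower
  exact abs_le.2 ⟨by linarith, hupper⟩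

theorem norm_sub_le_mul_finslerDist (hle : ∀ x ∈ U, ∀ ξ, ‖ξ‖ ≤ C * F x ξ) :
    ‖q - p‖ ≤ C * finslerDist U F p q := by
  obtain ⟨g, hg, hgqp⟩ := exists_dual_vector'' ℝ (q - p)
  rw [map_sub, RCLike.ofReal_real_eq_id, id_eq] at hgqp
  refine hgqp ▸ hF.sub_le_mul_finslerDist hconv hp hq hC (fun x _ => g.hasFDerivAt) fun x hx ξ => ?_
  exact (le_abs_self _).trans ((g.le_of_opNorm_le hg ξ).trans_eq (one_mul _) |>.trans (hle x hx ξ))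

end

end IsFinslerMetric

section

variable (hU : IsOpen U) (hconv : Convex ℝ U) (hbdd : Bornology.IsBounded U)
include hU hconv hbdd

theorem add_inv_funkMetric_smul_mem_closure (hx : x ∈ U) {ξ : Space n} (hξ : ξ ≠ 0) :
    x + (funkMetric U x ξ)⁻¹ • ξ ∈ closure U :=
  frontier_subset_closure
    (add_inv_funkMetric_smul_mem_frontier hU hx hconv (funkMetric_pos hU hx hbdd hξ))

theorem apply_le_mul_funkMetric (hx : x ∈ U) {f : Space n →L[ℝ] ℝ} {c : ℝ}
    (hf : ∀ z ∈ U, f z < c) (ξ : Space n) : f ξ ≤ (c - f x) * funkMetric U x ξ := by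
  rcases eq_or_ne ξ 0 with rfl | hξ
  · simp [funkMetric_eq_gauge]
  have hle : f (x + (funkMetric U x ξ)⁻¹ • ξ) ≤ c :=
    closure_minimal (fun z hz => (hf z hz).le) (isClosed_le f.continuous continuous_const)
      (add_inv_funkMetric_smul_mem_closure hU hconv hbdd hx hξ)
  rw [map_add, map_smul, smul_eq_mul] at hle
  rw [← div_le_iff₀ (funkMetric_pos hU hx hbdd hξ), div_eq_inv_mul]
  linarith

theorem norm_le_mul_funkMetric (hx : x ∈ U) {C : ℝ} (hC : ∀ z ∈ U, ‖z‖ ≤ C) (ξ : Space n) :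
    ‖ξ‖ ≤ 2 * C * funkMetric U x ξ := by
  rcases eq_or_ne ξ 0 with rfl | hξ
  · simp [funkMetric_eq_gauge]
  have hpos := funkMetric_pos hU hx hbdd hξ
  have hle : ‖x + (funkMetric U x ξ)⁻¹ • ξ‖ ≤ C :=
    closure_minimal hC (isClosed_le continuous_norm continuous_const)
      (add_inv_funkMetric_smul_mem_closure hU hconv hbdd hx hξ)
  have hsub := norm_sub_le (x + (funkMetric U x ξ)⁻¹ • ξ) x
  rw [add_sub_cancel_left, norm_smul, Real.norm_of_nonneg (inv_nonneg.2 hpos.le)] at hsub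
  rw [← div_le_iff₀ hpos, div_eq_inv_mul]
  linarith [hC x hx]

namespace IsFinslerMetric

variable (hF : IsFinslerMetric U F) {C : ℝ} (hC : 0 < C)
  (hle : ∀ x ∈ U, ∀ ξ, funkMetric U x ξ ≤ C * F x ξ)
include hF hC hle

theorem exists_norm_sub_le_mul_finslerDist :
    ∃ D, 0 < D ∧ ∀ p ∈ U, ∀ q ∈ U, ‖q - p‖ ≤ D * finslerDist U F p q := by
  obtain ⟨R, hR, hnorm⟩ := hbdd.exists_pos_norm_le
  have hD : 0 < 2 * R * C := by positivity
  refine ⟨2 * R * C, hD, fun p hp q hq => hF.norm_sub_le_mul_finslerDist hconv hp hq hD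
    fun x hx ξ => ?_⟩
  rw [mul_assoc]
  exact (norm_le_mul_funkMetric hU hconv hbdd hx hnorm ξ).trans
    (mul_le_mul_of_nonneg_left (hle x hx ξ) (by positivity))

theorem cauchySeq_of_finslerDist_lt {u : ℕ → Space n} (hu : ∀ i, u i ∈ U)
    (hcau : ∀ ε : ℝ, 0 < ε → ∃ N : ℕ, ∀ k,
      finslerDist U F (u N) (u (N + k)) < ε ∨ finslerDist U F (u (N + k)) (u N) < ε) :
    CauchySeq u := by
  obtain ⟨D, hD, hdist⟩ := hF.exists_norm_sub_le_mul_finslerDist hU hconv hbdd hC hle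
  refine Metric.cauchySeq_iff'.2 fun ε hε => ?_
  obtain ⟨N, hN⟩ := hcau (ε / D) (by positivity)
  refine ⟨N, fun i hi => ?_⟩
  obtain ⟨k, rfl⟩ := Nat.exists_eq_add_of_le hi
  rcases hN k with h | h <;> rw [lt_div_iff₀' hD] at h
  · rw [dist_eq_norm]
    exact (hdist _ (hu N) _ (hu (N + k))).trans_lt h
  · rw [dist_comm, dist_eq_norm]
    exact (hdist _ (hu (N + k)) _ (hu N)).trans_lt h

variable (hle' : ∀ x ∈ U, ∀ ξ, funkMetric U x (-ξ) ≤ C * F x ξ)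
include hle'

theorem abs_log_sub_log_le_mul_finslerDist (hp : p ∈ U) (hq : q ∈ U) {f : Space n →L[ℝ] ℝ} {c : ℝ}
    (hf : ∀ z ∈ U, f z < c) :
    |Real.log (c - f q) - Real.log (c - f p)| ≤ C * finslerDist U F p q := by
  refine hF.abs_sub_le_mul_finslerDist hconv hp hq hC (ψ := fun x => Real.log (c - f x))
    (fun x hx => (f.hasFDerivAt.const_sub c).log (sub_pos.2 (hf x hx)).ne') fun x hx ξ => ?_
  have hpos := sub_pos.2 (hf x hx)
  have hξ := (apply_le_mul_funkMetric hU hconv hbdd hx hf ξ).trans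
    (mul_le_mul_of_nonneg_left (hle x hx ξ) hpos.le)
  have hneg := (apply_le_mul_funkMetric hU hconv hbdd hx hf (-ξ)).trans
    (mul_le_mul_of_nonneg_left (hle' x hx ξ) hpos.le)
  rw [map_neg] at hneg
  rw [_root_.smul_apply, _root_.neg_apply, smul_eq_mul, abs_mul, abs_neg,
    abs_of_pos (inv_pos.2 hpos), inv_mul_le_iff₀ hpos]
  exact abs_le'.2 ⟨hξ, hneg⟩

theorem exists_tendsto_of_finslerDist_lt {u : ℕ → Space n} (hu : ∀ i, u i ∈ U)
    (hcau : ∀ ε : ℝ, 0 < ε → ∃ N : ℕ, ∀ k,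
      finslerDist U F (u N) (u (N + k)) < ε ∨ finslerDist U F (u (N + k)) (u N) < ε) :
    ∃ z ∈ U, Tendsto u atTop (𝓝 z) := by
  obtain ⟨z, hz⟩ := cauchySeq_tendsto_of_complete
    (hF.cauchySeq_of_finslerDist_lt hU hconv hbdd hC hle hu hcau)
  refine ⟨z, by_contra fun hzU => ?_, hz⟩
  obtain ⟨f, hf⟩ := geometric_hahn_banach_open_point hconv hU hzU
  have hlog (i j : ℕ) := hF.abs_log_sub_log_le_mul_finslerDist hU hconv hbdd hC hle hle'
    (hu i) (hu j) hf
  obtain ⟨N, hN⟩ := hcau 1 one_pos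
  have hlower (k : ℕ) : Real.log (f z - f (u N)) - C ≤ Real.log (f z - f (u (k + N))) := by
    rw [add_comm k]
    rcases hN k with h | h
    · linarith [(abs_le.1 (hlog N (N + k))).1, mul_lt_mul_of_pos_left h hC]
    · linarith [(abs_le.1 (hlog (N + k) N)).2, mul_lt_mul_of_pos_left h hC]
  have hexp (k : ℕ) := (Real.le_log_iff_exp_le (sub_pos.2 (hf _ (hu (k + N))))).1 (hlower k)
  have hlim : Tendsto (fun k => f z - f (u (k + N))) atTop (𝓝 (f z - f z)) :=
    tendsto_const_nhds.sub ((f.continuous.tendsto z).comp (hz.comp (tendsto_add_atTop_nat N)))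
  exact (Real.exp_pos _).not_ge (sub_self (f z) ▸ ge_of_tendsto' hlim hexp)

theorem isComplete_of_funkMetric_le : IsComplete U F := by
  refine ⟨fun u hu hcau => ?_, fun u hu hcau => ?_⟩ <;>
  refine hF.exists_tendsto_of_finslerDist_lt hU hconv hbdd hC hle hle' hu fun ε hε => ?_ <;>
  obtain ⟨N, hN⟩ := hcau ε hε
  · exact ⟨N, fun k => Or.inl (hN N le_rfl k)⟩
  · exact ⟨N, fun k => Or.inr (hN N le_rfl k)⟩

omit hC hle hle' in
theorem isComplete_of_hilbert (hH : ∀ x ∈ U, ∀ ξ : Space n, F x ξ = hilbertMetric U x ξ) :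
    IsComplete U F := by
  refine hF.isComplete_of_funkMetric_le hU hconv hbdd two_pos (fun x hx ξ => ?_)
    fun x hx ξ => ?_ <;>
  rw [hH x hx, hilbertMetric] <;>
  linarith [funkMetric_nonneg U x ξ, funkMetric_nonneg U x (-ξ)]

end IsFinslerMetric

end

end

section

variable {n : ℕ} {U : Set (Space n)} {F P : Space n → Space n → ℝ} {x y p q : Space n}

/-! ### Complete metrics of constant negative curvature -/

theorem segment_add_smul_subset {J : Set ℝ} (hJ : Convex ℝ J) {s t : ℝ} (hs : s ∈ J)
    (ht : t ∈ J) : segment ℝ (x + s • y) (x + t • y) ⊆ (fun r : ℝ => x + r • y) '' J := by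
  rintro _ ⟨a, b, ha, hb, hab, rfl⟩
  refine ⟨a • s + b • t, hJ hs ht ha hb hab, ?_⟩
  obtain rfl := eq_sub_of_add_eq' hab
  module

section

variable (hU : IsOpen U) (hconv : Convex ℝ U) (hbdd : Bornology.IsBounded U) (hx : x ∈ U)
  (hy : y ≠ 0)
include hU hconv hbdd hx hy

theorem add_smul_mem_of_mem_Ico {t : ℝ} (ht : t ∈ Ico 0 (funkMetric U x y)⁻¹) :
    x + t • y ∈ U := by
  rw [add_smul_mem_iff hU hx hconv ht.1, ← lt_inv_mul_iff₀' (funkMetric_pos hU hx hbdd hy), mul_one]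
  exact ht.2

theorem exists_divergent_seq (M : ℝ) :
    ∃ t : ℕ → ℝ, StrictMono t ∧ (∀ i, t i ∈ Ico 0 (funkMetric U x y)⁻¹) ∧
      (∀ ε : ℝ, 0 < ε → ∃ N : ℕ, ∀ i, N ≤ i → ∀ k, (t (i + k) - t i) * M < ε) ∧
      ¬∃ z ∈ U, Tendsto (fun i => x + t i • y) atTop (𝓝 z) := by
  have hpos := funkMetric_pos hU hx hbdd hy
  obtain ⟨t, hmono, ht, hlim⟩ := exists_seq_strictMono_tendsto' (inv_pos.2 hpos)
  refine ⟨t, hmono, fun i => Ioo_subset_Ico_self (ht i), fun ε hε => ?_, ?_⟩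
  · obtain ⟨N, hN⟩ := Metric.cauchySeq_iff.1 (hlim.mul_const M).cauchySeq ε hε
    refine ⟨N, fun i hi k => ?_⟩
    rw [sub_mul]
    exact (le_abs_self _).trans_lt (hN (i + k) (hi.trans (Nat.le_add_right i k)) i hi)
  · rintro ⟨z, hz, hzlim⟩
    rw [tendsto_nhds_unique hzlim ((hlim.smul_const y).const_add x)] at hz
    exact (add_inv_funkMetric_smul_mem_frontier hU hx hconv hpos).2 (hU.interior_eq.symm ▸ hz)

namespace IsFinslerMetric

variable (hF : IsFinslerMetric U F)
include hF

theorem finslerDist_add_smul_le {s t : ℝ} (hs : s ∈ Ico 0 (funkMetric U x y)⁻¹)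
    (ht : t ∈ Ico 0 (funkMetric U x y)⁻¹) {w : Space n} {c M : ℝ} (hc : 0 ≤ c)
    (hw : (t - s) • y = c • w)
    (hM : M ∈ upperBounds ((fun t : ℝ => F (x + t • y) w) '' Ico 0 (funkMetric U x y)⁻¹)) :
    finslerDist U F (x + s • y) (x + t • y) ≤ c * M := by
  have hmem {r : ℝ} := add_smul_mem_of_mem_Ico hU hconv hbdd hx hy (t := r)
  refine hF.finslerDist_le (hconv.segment_subset (hmem hs) (hmem ht)) fun z hz => ?_
  obtain ⟨r, hr, rfl⟩ := segment_add_smul_subset (convex_Ico _ _) hs ht hz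
  rw [add_sub_add_left_eq_sub, ← sub_smul, hw, hF.smul _ (hmem hr) c hc]
  exact mul_le_mul_of_nonneg_left (hM ⟨r, hr, rfl⟩) hc

theorem not_bddAbove_of_isForwardComplete (hc : IsForwardComplete U F) :
    ¬BddAbove ((fun t : ℝ => F (x + t • y) y) '' Ico 0 (funkMetric U x y)⁻¹) := by
  rintro ⟨M, hM⟩
  obtain ⟨t, hmono, ht, hcau, hdiv⟩ := exists_divergent_seq hU hconv hbdd hx hy M
  refine hdiv (hc _ (fun i => add_smul_mem_of_mem_Ico hU hconv hbdd hx hy (ht i)) fun ε hε => ?_)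
  obtain ⟨N, hN⟩ := hcau ε hε
  refine ⟨N, fun i hi k => lt_of_le_of_lt ?_ (hN i hi k)⟩
  exact hF.finslerDist_add_smul_le hU hconv hbdd hx hy (ht i) (ht (i + k))
    (sub_nonneg.2 (hmono.monotone (Nat.le_add_right i k))) rfl hM

theorem not_bddAbove_of_isBackwardComplete (hc : IsBackwardComplete U F) :
    ¬BddAbove ((fun t : ℝ => F (x + t • y) (-y)) '' Ico 0 (funkMetric U x y)⁻¹) := by
  rintro ⟨M, hM⟩
  obtain ⟨t, hmono, ht, hcau, hdiv⟩ := exists_divergent_seq hU hconv hbdd hx hy M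
  refine hdiv (hc _ (fun i => add_smul_mem_of_mem_Ico hU hconv hbdd hx hy (ht i)) fun ε hε => ?_)
  obtain ⟨N, hN⟩ := hcau ε hε
  refine ⟨N, fun i hi k => lt_of_le_of_lt ?_ (hN i hi k)⟩
  exact hF.finslerDist_add_smul_le hU hconv hbdd hx hy (ht (i + k)) (ht i)
    (sub_nonneg.2 (hmono.monotone (Nat.le_add_right i k))) (by module) hM

end IsFinslerMetric

end

theorem eq_add_mul_of_hasDerivAt {I : Set ℝ} (hI : IsOpen I) (hc : IsPreconnected I)
    (h0 : (0 : ℝ) ∈ I) {g : ℝ → ℝ} {c : ℝ} (hg : ∀ t ∈ I, HasDerivAt g c t) {t : ℝ} (ht : t ∈ I) :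
    g t = g 0 + c * t := by
  have hderiv : ∀ s ∈ I, HasDerivAt (fun s => g s - c * s) 0 s := fun s hs =>
    ((hg s hs).fun_sub ((hasDerivAt_id s).const_mul c)).congr_deriv (by simp)
  have h := hI.is_const_of_deriv_eq_zero hc
    (fun s hs => (hderiv s hs).differentiableAt.differentiableWithinAt)
    (fun s hs => (hderiv s hs).deriv) ht h0
  linarith

/-- The invariant `(f² - p²) / f` makes `1 / f` a quadratic polynomial. -/
theorem mul_mul_eq_of_hasDerivAt {I : Set ℝ} (hI : IsOpen I) (hc : IsPreconnected I)
    (h0 : (0 : ℝ) ∈ I) {f p : ℝ → ℝ} (hne : ∀ t ∈ I, f t ≠ 0)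
    (hf : ∀ t ∈ I, HasDerivAt f (2 * p t * f t) t)
    (hp : ∀ t ∈ I, HasDerivAt p (p t ^ 2 + f t ^ 2) t) {t : ℝ} (ht : t ∈ I) :
    f t * (1 - (f 0 + p 0) * t) * (1 + (f 0 - p 0) * t) = f 0 := by
  set k := (f 0 ^ 2 - p 0 ^ 2) / f 0 with hk
  have hinvariant (s : ℝ) (hs : s ∈ I) : (f s ^ 2 - p s ^ 2) / f s = k := by
    have hderiv : ∀ s ∈ I, HasDerivAt (fun s => (f s ^ 2 - p s ^ 2) / f s) 0 s := fun s hs => by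
      have := hne s hs
      refine ((((hf s hs).fun_pow 2).fun_sub ((hp s hs).fun_pow 2)).fun_div
        (hf s hs) this).congr_deriv ?_
      field_simp
      ring
    simpa only [zero_mul, add_zero] using eq_add_mul_of_hasDerivAt hI hc h0 hderiv hs
  have hquot (s : ℝ) (hs : s ∈ I) : p s / f s = p 0 / f 0 + k * s := by
    refine eq_add_mul_of_hasDerivAt (g := fun s => p s / f s) hI hc h0 (fun s hs => ?_) hs
    have := hne s hs
    refine ((hp s hs).fun_div (hf s hs) this).congr_deriv ?_
    rw [← hinvariant s hs]
    field_simp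
    ring
  have hinv : (f t)⁻¹ + 2 * (p 0 / f 0) * t + k * t ^ 2 = (f 0)⁻¹ := by
    have hderiv : ∀ s ∈ I,
        HasDerivAt (fun s => (f s)⁻¹ + 2 * (p 0 / f 0) * s + k * s ^ 2) 0 s := fun s hs => by
      have := hne s hs
      refine ((((hf s hs).fun_inv this).fun_add ((hasDerivAt_id s).const_mul
        (2 * (p 0 / f 0)))).fun_add (((hasDerivAt_id s).fun_pow 2).const_mul k)).congr_deriv ?_
      have hdiv : -(2 * p s * f s) / f s ^ 2 = -2 * (p s / f s) := by field_simp
      rw [hdiv, hquot s hs]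
      simp only [id, Nat.cast_ofNat, Nat.add_one_sub_one, pow_one, mul_one]
      ring
    simpa using eq_add_mul_of_hasDerivAt hI hc h0 hderiv ht
  have hf0 := hne 0 h0
  have hft := hne t ht
  rw [hk] at hinv
  field_simp at hinv
  linear_combination -hinv

theorem eq_of_not_bddAbove {f : ℝ → ℝ} {α A B f₀ : ℝ} (hα : 0 < α) (hf₀ : 0 < f₀)
    (hAB : 0 < A + B) (hf : ∀ t ∈ Ico 0 α⁻¹, f t * (1 - A * t) * (1 + B * t) = f₀)
    (hub : ¬BddAbove (f '' Ico 0 α⁻¹)) : A = α := by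
  have hA : A ≤ α := by
    by_contra! h
    have hA0 := hα.trans h
    have hpole := hf A⁻¹ ⟨(inv_pos.2 hA0).le, inv_strictAnti₀ hα h⟩
    rw [mul_inv_cancel₀ hA0.ne', sub_self, mul_zero, zero_mul] at hpole
    exact hf₀.ne hpole
  by_contra hne
  have hpos {c : ℝ} (hc : c < α) {t : ℝ} (ht : t ∈ Icc 0 α⁻¹) : 0 < 1 - c * t := by
    rw [sub_pos]
    rcases le_or_gt c 0 with h | h
    · exact (mul_nonpos_of_nonpos_of_nonneg h ht.1).trans_lt one_pos
    · calc c * t ≤ c * α⁻¹ := mul_le_mul_of_nonneg_left ht.2 h.le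
        _ < 1 := (mul_inv_lt_iff₀ hα).2 (by rwa [one_mul])
  have hden (t : ℝ) (ht : t ∈ Icc 0 α⁻¹) : 0 < (1 - A * t) * (1 + B * t) := by
    have hB := hpos (c := -B) (by linarith) ht
    rw [neg_mul, sub_neg_eq_add] at hB
    exact mul_pos (hpos (hA.lt_of_ne hne) ht) hB
  have hcont : ContinuousOn (fun t => f₀ / ((1 - A * t) * (1 + B * t))) (Icc 0 α⁻¹) :=
    continuousOn_const.div (by fun_prop) fun t ht => (hden t ht).ne'
  have heq : EqOn f (fun t => f₀ / ((1 - A * t) * (1 + B * t))) (Ico 0 α⁻¹) := fun t ht => by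
    rw [eq_div_iff (hden t (Ico_subset_Icc_self ht)).ne', ← mul_assoc, hf t ht]
  rw [heq.image_eq] at hub
  exact hub ((isCompact_Icc.bddAbove_image hcont).mono (image_mono Ico_subset_Icc_self))

namespace IsProjectiveFactor

variable (hP : IsProjectiveFactor U F P) (hF : IsStronglyConvex U F) (hU : IsOpen U)
  (hconv : Convex ℝ U) (hn : 2 ≤ n) (hK : HasConstantFlagCurvature U F (-1)) (hx : x ∈ U)
  (hy : y ≠ 0)
include hP hF hU hconv hn hK hx hy

theorem mul_mul_eq_of_flagCurvature {t : ℝ} (ht : x + t • y ∈ U) :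
    F (x + t • y) y * (1 - (F x y + P x y) * t) * (1 + (F x y - P x y) * t) = F x y := by
  let I : Set ℝ := {s | x + s • y ∈ U}
  have hI : IsOpen I := hU.preimage (by fun_prop)
  have hIconv : Convex ℝ I :=
    (hconv.translate_preimage_right x).linear_preimage (LinearMap.toSpanSingleton ℝ (Space n) y)
  have h0 : (0 : ℝ) ∈ I := by simpa [I] using hx
  have h := mul_mul_eq_of_hasDerivAt hI hIconv.isPreconnected h0
    (f := fun s => F (x + s • y) y) (p := fun s => P (x + s • y) y)
    (fun s hs => (hF.pos _ hs y hy).ne')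
    (fun s hs => (hF.isSmoothOffZero.hasDerivAt_flatSpray hU hs hy).congr_deriv
      (hP.flatSpray_eq hF hU hs hy))
    (fun s hs => ((hP.isSmoothOffZero hF hU).hasDerivAt_flatSpray hU hs hy).congr_deriv
      (hP.flatSpray_of_flagCurvature hF hU hn hK hs hy)) ht
  simpa only [zero_smul, add_zero] using h

variable (hbdd : Bornology.IsBounded U)
include hbdd

theorem add_eq_funkMetric (hc : IsForwardComplete U F) : F x y + P x y = funkMetric U x y := by
  have hpos := hF.pos x hx y hy
  exact eq_of_not_bddAbove (funkMetric_pos hU hx hbdd hy) hpos (B := F x y - P x y) (by linarith)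
    (fun t ht => hP.mul_mul_eq_of_flagCurvature hF hU hconv hn hK hx hy
      (add_smul_mem_of_mem_Ico hU hconv hbdd hx hy ht))
    (hF.not_bddAbove_of_isForwardComplete hU hconv hbdd hx hy hc)

theorem sub_eq_funkMetric_neg (hc : IsBackwardComplete U F) :
    F x y - P x y = funkMetric U x (-y) := by
  have hpos := hF.pos x hx y hy
  have hy' := neg_ne_zero.2 hy
  have hub := hF.not_bddAbove_of_isBackwardComplete hU hconv hbdd hx hy' hc
  rw [neg_neg] at hub
  refine eq_of_not_bddAbove (funkMetric_pos hU hx hbdd hy') hpos (B := F x y + P x y)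
    (by linarith) (fun t ht => ?_) hub
  have hmem := add_smul_mem_of_mem_Ico hU hconv hbdd hx hy' ht
  rw [smul_neg, ← neg_smul] at hmem ⊢
  linear_combination hP.mul_mul_eq_of_flagCurvature hF hU hconv hn hK hx hy hmem

end IsProjectiveFactor

theorem IsStronglyConvex.eq_hilbertMetric (hF : IsStronglyConvex U F) (hU : IsOpen U)
    (hconv : Convex ℝ U) (hbdd : Bornology.IsBounded U) (hn : 2 ≤ n)
    (hflat : IsProjectivelyFlat U F) (hcomplete : IsComplete U F)
    (hK : HasConstantFlagCurvature U F (-1)) (hx : x ∈ U) (ξ : Space n) :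
    F x ξ = hilbertMetric U x ξ := by
  rcases eq_or_ne ξ 0 with rfl | hξ
  · simp [hF.apply_zero hx, hilbertMetric, funkMetric_eq_gauge]
  obtain ⟨P, hP⟩ := hF.exists_isProjectiveFactor hU hflat
  rw [hilbertMetric, ← hP.add_eq_funkMetric hF hU hconv hn hK hx hξ hbdd hcomplete.1,
    ← hP.sub_eq_funkMetric_neg hF hU hconv hn hK hx hξ hbdd hcomplete.2]
  ring

end

end Finsler

theorem theoremA (n : ℕ) (hn : 2 ≤ n) (U : Set (Finsler.Space n)) (hopen : IsOpen U)
    (hconv : Convex ℝ U) (hbdd : Bornology.IsBounded U)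
    (F : Finsler.Space n → Finsler.Space n → ℝ) (hF : Finsler.IsStronglyConvex U F) :
    (∀ x ∈ U, ∀ ξ : Finsler.Space n, F x ξ = Finsler.hilbertMetric U x ξ) ↔
      (Finsler.IsProjectivelyFlat U F ∧ Finsler.IsComplete U F ∧
        Finsler.HasConstantFlagCurvature U F (-1)) := by
  constructor
  · intro hH
    have hpair := hF.isBerwaldPair_of_hilbert hopen hconv hbdd hH
    have hP := hpair.isProjectiveFactor hopen hF
    exact ⟨hP.isProjectivelyFlat hF hopen, hF.isComplete_of_hilbert hopen hconv hbdd hH,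
      hpair.hasConstantFlagCurvature hopen hF⟩
  · rintro ⟨hflat, hcomplete, hK⟩ x hx ξ
    exact hF.eq_hilbertMetric hopen hconv hbdd hn hflat hcomplete hK hx ξ
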